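/- Let $V$ be a finite-dimensional real vector space and let $W$ be a finite group of linear automorphisms of $V$ generated by reflections (involutions whose fixed space is a hyperplane). Let $\mathcal A$ be its reflection arrangement, i.e. the set of hyperplanes fixed by some reflection in $W$, and let $k$ be a field whose characteristic does not divide $|W|$. For each $H\in\mathcal A$ let $H^+,H^-$ be the two open half-spaces of $H$ and $H^0=H$. A face is a non-empty set $x=\bigcap_{H\in\mathcal A}H^{\sigma_H(x)}$ with $\sigma_H(x)\in\{+,0,-\}$. The set $\mathcal F$ of faces is a monoid under the product given by $\sigma_H(xy)=\sigma_H(x)$ if $\sigma_H(x)\neq0$ and $\sigma_H(xy)=\sigma_H(y)$ otherwise. The group $W$ acts on $\mathcal F$, hence on the semigroup algebra $k\mathcal F$; let $(k\mathcal F)^W$ be the subalgebra of invariants. The support of a face $x$ is the intersection of all $H\in\mathcal A$ containing $x$; $\mathcal L$ is the set of supports of faces ordered by inclusion, and $\mathcal L/W$ is its set of $W$-orbits, ordered by $\mathcal O_X\le\mathcal O_Y$ iff $w(X)\subseteq Y$ for some $w\in W$. For a finite-dimensional $k$-algebra $A$ that is split basic (that is, $A/\operatorname{rad}A\cong k^n$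 as $k$-algebras for some $n$), the quiver of $A$ is built from a complete system $(e_v)_{v}$ of primitive orthogonal idempotents: it has one vertex for each $v$, and $\dim_k e_y(\operatorname{rad}A/\operatorname{rad}^2A)e_x$ arrows from $x$ to $y$. The algebra $A$ is quasi-hereditary if it has a chain $0=J_0\subset J_1\subset\dots\subset J_n=A$ of two-sided ideals such that, for each $t$, $J=J_{t+1}/J_t$ is a heredity ideal of $B=A/J_t$: $J^2=J$, $J(\operatorname{rad}B)J=0$, and $J$ is projective as a $B$-module. Then the following hold. 1. $(k\mathcal F)^W$ is a split basic algebra. 2. There are families $(\ell_X)_{X\in\mathcal L}$ such that $\ell_X\in k\mathcal F$ is a linear combination of faces of support $X$ with coefficients summing to $1$ and $w(\ell_X)=\ell_{w(X)}$ for all $w\in W$, $X\in\mathcal L$. For every such family, define recursively $e_X=\ell_X-\sum_{Y>X}\ell_Xe_Y$. The elements $\varepsilon_{\mathcal O}=\sum_{X\in\mathcal O}e_X$, $\mathcal O\in\mathcal L/W$, form a complete system of primitive orthogonal idempotents of $(k\mathcal F)^W$, so that the quiver $\Gamma$ of $(k\mathcal F)^W$ has vertex set $\mathcal L/W$. If there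 is an arrow $\mathcal O'\to\mathcal O$ in $\Gamma$, then $\mathcal O<\mathcal O'$ in $\mathcal L/W$. 3. The quiver of $(k\mathcal F)^W$, built from any complete system of primitive orthogonal idempotents, contains no oriented cycles. 4. $(k\mathcal F)^W$ is quasi-hereditary. 5. Let $c$ be a chamber (a connected component of $V\setminus\bigcup_{H\in\mathcal A}H$), let $S$ be the set of reflections of $W$ in the walls of $c$ (those $H\in\mathcal A$ for which $H\cap\overline c$ spans $H$), and for $J\subseteq S$ let $x_J\in kW$ be the sum of the elements $w$ of minimal length (with respect to $S$) in their coset $w\langle J\rangle$. The span of the $x_J$, $J\subseteq S$, is a subalgebra of the group algebra $kW$, the descent algebra of $(W,S)$, and this algebra is quasi-hereditary. -/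

import Mathlib

noncomputable section

namespace FaceAlg

/-! ## Finite-dimensional algebras: radical, idempotents, quiver, heredity chains -/

section Algebra

variable (k : Type*) [Field k] {A : Type*} [Ring A] [Algebra k A]

/-- `A` is split basic: `A / rad A` is isomorphic, as a `k`-algebra, to a finite direct product of
copies of `k`. -/
def IsSplitBasic (k A : Type*) [Field k] [Ring A] [Algebra k A] : Prop :=
  ∃ n : ℕ, Nonempty ((A ⧸ Ring.jacobson A) ≃ₐ[k] (Fin n → k))

/-- A (nonzero) idempotent that is not a sum of two nonzero orthogonal idempotents. -/
def IsPrimitiveIdempotent (e : A) : Prop :=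
  IsIdempotentElem e ∧ e ≠ 0 ∧
    ∀ f g : A, IsIdempotentElem f → IsIdempotentElem g → f * g = 0 → g * f = 0 →
      e = f + g → f = 0 ∨ g = 0

/-- A complete system of primitive orthogonal idempotents, indexed by a finite type. -/
def IsCompleteSystem {ι : Type*} [Finite ι] (e : ι → A) : Prop :=
  (∀ i, IsPrimitiveIdempotent (e i)) ∧ (∀ i j, i ≠ j → e i * e j = 0) ∧
    (letI := Fintype.ofFinite ι; ∑ i, e i) = 1

/-- The Jacobson radical of `A` as a `k`-subspace. -/
def radical (k A : Type*) [Field k] [Ring A] [Algebra k A] : Submodule k A :=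
  (Ring.jacobson A).restrictScalars k

/-- The linear map `r ↦ f * r * e`. -/
def sandwich (f e : A) : A →ₗ[k] A :=
  LinearMap.mulLeft k f ∘ₗ LinearMap.mulRight k e

/-- The `k`-subspace `f (rad A / rad² A) e`, realised inside `A / rad² A`. -/
def arrowSpace (f e : A) : Submodule k (A ⧸ (radical k A * radical k A)) :=
  ((radical k A).map (sandwich k f e)).map (radical k A * radical k A).mkQ

/-- The quiver of `A` built from the family `e` of idempotents: one vertex for each index, and
`dim e_y (rad A / rad² A) e_x` arrows from `x` to `y`. -/
@[reducible] def quiverOf {ι : Type*} (e : ι → A) : Quiver ι where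
  Hom x y := Fin (Module.finrank k (arrowSpace k (e y) (e x)))

/-- A quiver has no oriented cycles: every path from a vertex to itself is trivial. -/
def NoOrientedCycles {ι : Type*} (Q : Quiver ι) : Prop :=
  ∀ (v : ι) (p : @Quiver.Path ι Q v v), @Quiver.Path.length ι Q v v p = 0

/-- A two-sided ideal `J` is a heredity ideal if `J² = J`, `J (rad A) J = 0` and `J` is projective
as a left `A`-module. (For an ideal with the first two properties in a finite-dimensional algebra,
projectivity on the left and on the right are equivalent.) -/
def IsHeredityIdeal {A : Type*} [Ring A] (J : Ideal A) : Prop :=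
  J.IsTwoSided ∧ J * J = J ∧ (∀ a ∈ J, ∀ r ∈ Ring.jacobson A, ∀ b ∈ J, a * r * b = 0) ∧
    Module.Projective A J

/-- `A` is quasi-hereditary: there is a chain `0 = J₀ ⊂ J₁ ⊂ ⋯ ⊂ Jₙ = A` of two-sided ideals such
that `Jₜ₊₁ / Jₜ` is a heredity ideal of `A / Jₜ` for every `t < n`. -/
def IsQuasiHereditary (A : Type*) [Ring A] : Prop :=
  ∃ (n : ℕ) (J : ℕ → Ideal A) (_ : ∀ t, (J t).IsTwoSided),
    J 0 = ⊥ ∧ J n = ⊤ ∧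
      ∀ t < n, J t < J (t + 1) ∧
        IsHeredityIdeal ((J (t + 1)).map (Ideal.Quotient.mk (J t)))

end Algebra

/-! ## Reflections and the reflection arrangement -/

section Arrangement

variable {V : Type*} [AddCommGroup V] [Module ℝ V]

/-- The subspace of vectors fixed by `s`. -/
def fixedSpace (s : V ≃ₗ[ℝ] V) : Submodule ℝ V :=
  LinearMap.eqLocus (s : V →ₗ[ℝ] V) LinearMap.id

lemma mem_fixedSpace {s : V ≃ₗ[ℝ] V} {v : V} : v ∈ fixedSpace s ↔ s v = v := Iff.rfl

/-- A reflection: an involution whose fixed space is a hyperplane (a maximal proper subspace). -/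
def IsReflection (s : V ≃ₗ[ℝ] V) : Prop :=
  s * s = 1 ∧ IsCoatom (fixedSpace s)

variable (W : Subgroup (V ≃ₗ[ℝ] V))

/-- The reflection arrangement of `W`: the hyperplanes fixed by the reflections in `W`. -/
def arrangement : Set (Submodule ℝ V) :=
  {H | ∃ s ∈ W, IsReflection s ∧ fixedSpace s = H}

instance [Finite W] : Finite (arrangement W) := by
  have : Set.Finite (W : Set (V ≃ₗ[ℝ] V)) := Set.toFinite (W : Set (V ≃ₗ[ℝ] V))
  refine ((this.image fixedSpace).subset ?_).to_subtype
  rintro H ⟨s, hs, -, rfl⟩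
  exact ⟨s, hs, rfl⟩

lemma exists_form (H : arrangement W) : ∃ f : Module.Dual ℝ V, LinearMap.ker f = H.1 := by
  obtain ⟨_, s, -, hs, rfl⟩ := H
  obtain ⟨f, hf, hle⟩ := Submodule.exists_le_ker_of_lt_top _ hs.2.lt_top
  refine ⟨f, ?_⟩
  rcases hs.2.le_iff.1 hle with h | h
  · exact absurd (LinearMap.ker_eq_top.1 h) hf
  · exact h

/-- A fixed linear form with kernel `H`; its sign labels the two open half spaces of `H`. -/
def form (H : arrangement W) : Module.Dual ℝ V := (exists_form W H).choose

lemma ker_form (H : arrangement W) : LinearMap.ker (form W H) = H.1 := (exists_form W H).choose_spec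

/-- `H⁺`, `H⁻`, or `H⁰ = H`. -/
def halfSpace (H : arrangement W) (σ : SignType) : Set V :=
  {v | SignType.sign (form W H v) = σ}

/-- A face of the arrangement: a nonempty intersection `⋂_H H^{σ_H}`. -/
def Face : Type _ :=
  {x : Set V // x.Nonempty ∧ ∃ σ : arrangement W → SignType, x = ⋂ H, halfSpace W H (σ H)}

variable {W}

/-- The sign sequence of a face. -/
def Face.sign (x : Face W) : arrangement W → SignType := x.2.2.choose

lemma Face.mem_iff (x : Face W) {v : V} :
    v ∈ x.1 ↔ ∀ H, SignType.sign (form W H v) = x.sign H := by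
  conv_lhs => rw [x.2.2.choose_spec]
  simp [halfSpace, Face.sign]

lemma Face.ext_sign {x y : Face W} (h : x.sign = y.sign) : x = y := by
  apply Subtype.ext
  ext v
  rw [x.mem_iff, y.mem_iff, h]

/-- The face with a given realisable sign sequence. -/
def Face.mk (σ : arrangement W → SignType)
    (h : ∃ v : V, ∀ H, SignType.sign (form W H v) = σ H) : Face W :=
  ⟨⋂ H, halfSpace W H (σ H), by
    obtain ⟨v, hv⟩ := h
    exact ⟨v, by simpa [halfSpace] using hv⟩, σ, rfl⟩

lemma Face.sign_eq {x : Face W} {v : V} (hv : v ∈ x.1) (H : arrangement W) :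
    x.sign H = SignType.sign (form W H v) := (x.mem_iff.1 hv H).symm

@[simp] lemma Face.sign_mk (σ : arrangement W → SignType)
    (h : ∃ v : V, ∀ H, SignType.sign (form W H v) = σ H) : (Face.mk σ h).sign = σ := by
  obtain ⟨v, hv⟩ := h
  have : v ∈ (Face.mk σ ⟨v, hv⟩).1 := by simpa [Face.mk, halfSpace] using hv
  funext H
  rw [Face.sign_eq this, hv]

lemma Face.exists_point (x : Face W) : ∃ v : V, ∀ H, SignType.sign (form W H v) = x.sign H := by
  obtain ⟨v, hv⟩ := x.2.1
  exact ⟨v, x.mem_iff.1 hv⟩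

instance [Finite W] : Finite (Face W) :=
  Finite.of_injective Face.sign fun _ _ => Face.ext_sign

/-- Moving a small distance from `p` towards `q`. -/
lemma exists_mul_point [Finite W] (p q : V) :
    ∃ v : V, ∀ H : arrangement W, SignType.sign (form W H v) =
      if SignType.sign (form W H p) ≠ 0 then SignType.sign (form W H p)
      else SignType.sign (form W H q) := by
  have key : ∀ᶠ ε : ℝ in nhdsWithin 0 (Set.Ioi 0), ∀ H : arrangement W,
      SignType.sign (form W H (p + ε • q)) =
        if SignType.sign (form W H p) ≠ 0 then SignType.sign (form W H p)
        else SignType.sign (form W H q) := by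
    rw [Filter.eventually_all]
    intro H
    simp only [map_add, map_smul, smul_eq_mul]
    have hc : Filter.Tendsto (fun ε : ℝ => form W H p + ε * form W H q)
        (nhdsWithin 0 (Set.Ioi 0)) (nhds (form W H p)) := by
      have : Continuous (fun ε : ℝ => form W H p + ε * form W H q) := by fun_prop
      have h := this.tendsto 0
      simp only [zero_mul, add_zero] at h
      exact h.mono_left nhdsWithin_le_nhds
    rcases lt_trichotomy (form W H p) 0 with h | h | h
    · filter_upwards [hc.eventually_lt_const h] with ε hε
      simp [sign_neg h, sign_neg hε]
    · filter_upwards [self_mem_nhdsWithin] with ε hε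
      simp [h, sign_mul, sign_pos (Set.mem_Ioi.1 hε)]
    · filter_upwards [hc.eventually_const_lt h] with ε hε
      simp [sign_pos h, sign_pos hε]
  obtain ⟨ε, hε⟩ := key.exists
  exact ⟨_, hε⟩

/-- The product of faces, given on sign sequences. -/
instance [Finite W] : Mul (Face W) where
  mul x y := Face.mk (fun H => if x.sign H ≠ 0 then x.sign H else y.sign H) (by
    obtain ⟨p, hp⟩ := x.exists_point
    obtain ⟨q, hq⟩ := y.exists_point
    obtain ⟨v, hv⟩ := exists_mul_point (W := W) p q
    exact ⟨v, fun H => by rw [hv, hp, hq]⟩)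

instance : One (Face W) where
  one := Face.mk (fun _ => 0) ⟨0, by simp⟩

lemma Face.sign_mul [Finite W] (x y : Face W) (H : arrangement W) :
    (x * y).sign H = if x.sign H ≠ 0 then x.sign H else y.sign H :=
  congrFun (Face.sign_mk _ _) H

lemma Face.sign_one (H : arrangement W) : (1 : Face W).sign H = 0 :=
  congrFun (Face.sign_mk _ _) H

instance [Finite W] : Monoid (Face W) where
  mul_assoc x y z := Face.ext_sign <| by
    funext H
    simp only [Face.sign_mul]
    split_ifs <;> simp_all
  one_mul x := Face.ext_sign <| by
    funext H
    simp [Face.sign_mul, Face.sign_one]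
  mul_one x := Face.ext_sign <| by
    funext H
    simp only [Face.sign_mul, Face.sign_one]
    split_ifs <;> simp_all

/-! ### The action of `W` on hyperplanes and faces -/

lemma fixedSpace_conj (w s : V ≃ₗ[ℝ] V) :
    fixedSpace (w * s * w⁻¹) = (fixedSpace s).map (w : V →ₗ[ℝ] V) := by
  ext v
  simp only [Submodule.mem_map, mem_fixedSpace]
  constructor
  · intro h
    refine ⟨w⁻¹ v, ?_, LinearEquiv.apply_symm_apply w v⟩
    have h2 : w (s (w⁻¹ v)) = v := h
    apply w.injective
    rw [h2]
    exact (LinearEquiv.apply_symm_apply w v).symm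
  · rintro ⟨u, hu, rfl⟩
    change w (s (w.symm (w u))) = w u
    rw [LinearEquiv.symm_apply_apply, hu]

lemma map_mem_arrangement (w : W) {H : Submodule ℝ V} (hH : H ∈ arrangement W) :
    H.map ((w : V ≃ₗ[ℝ] V) : V →ₗ[ℝ] V) ∈ arrangement W := by
  obtain ⟨s, hs, ⟨hss, hc⟩, rfl⟩ := hH
  refine ⟨w.1 * s * w.1⁻¹, W.mul_mem (W.mul_mem w.2 hs) (W.inv_mem w.2), ⟨?_, ?_⟩,
    fixedSpace_conj _ _⟩
  · have : w.1 * s * w.1⁻¹ * (w.1 * s * w.1⁻¹) = w.1 * (s * s) * w.1⁻¹ := by group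
    rw [this, hss, mul_one, mul_inv_cancel]
  · rw [fixedSpace_conj]
    exact (OrderIso.isCoatom_iff (Submodule.orderIsoMapComap (w : V ≃ₗ[ℝ] V)) _).2 hc

/-- The image of a hyperplane of the arrangement under `w`. -/
def mapHyp (w : W) (H : arrangement W) : arrangement W := ⟨_, map_mem_arrangement w H.2⟩

lemma form_mapHyp (w : W) (H : arrangement W) :
    ∃ c : ℝ, c ≠ 0 ∧ ∀ v, form W (mapHyp w H) (w.1 v) = c * form W H v := by
  have hk : ∀ v, form W (mapHyp w H) (w.1 v) = 0 ↔ form W H v = 0 := by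
    intro v
    rw [← LinearMap.mem_ker, ← LinearMap.mem_ker, ker_form, ker_form]
    change w.1 v ∈ H.1.map ((w : V ≃ₗ[ℝ] V) : V →ₗ[ℝ] V) ↔ _
    simp
  have hne : ∃ u, form W H u ≠ 0 := by
    by_contra! h
    have h1 : LinearMap.ker (form W H) = ⊤ := by
      ext v
      simp [h v]
    rw [ker_form] at h1
    obtain ⟨s, -, hs, hs'⟩ := H.2
    exact hs.2.1 (hs'.trans h1)
  obtain ⟨u, hu⟩ := hne
  refine ⟨form W (mapHyp w H) (w.1 u) / form W H u, div_ne_zero (mt (hk u).1 hu) hu, fun v => ?_⟩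
  have h0 : form W H (form W H u • v - form W H v • u) = 0 := by
    simp [mul_comm]
  have h1 := (hk _).2 h0
  simp only [map_sub, map_smul, smul_eq_mul] at h1
  field_simp
  linarith

lemma mapHyp_inv (w : W) (H : arrangement W) : mapHyp w (mapHyp w⁻¹ H) = H := by
  apply Subtype.ext
  change (H.1.map (((w⁻¹ : W) : V ≃ₗ[ℝ] V) : V →ₗ[ℝ] V)).map ((w : V ≃ₗ[ℝ] V) : V →ₗ[ℝ] V) = H.1
  rw [← Submodule.map_comp]
  convert Submodule.map_id H.1
  ext v
  exact LinearEquiv.apply_symm_apply (w : V ≃ₗ[ℝ] V) v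

lemma image_isFace (w : W) (x : Face W) :
    (w.1 '' x.1).Nonempty ∧
      ∃ σ : arrangement W → SignType, w.1 '' x.1 = ⋂ H, halfSpace W H (σ H) := by
  refine ⟨x.2.1.image _, ?_⟩
  obtain ⟨p, hp⟩ := x.exists_point
  refine ⟨fun H => SignType.sign (form W H (w.1 p)), ?_⟩
  have key : ∀ v, w.1 v ∈ (⋂ H, halfSpace W H (SignType.sign (form W H (w.1 p)))) ↔ v ∈ x.1 := by
    intro v
    rw [x.mem_iff]
    simp only [halfSpace, Set.mem_iInter, Set.mem_ofPred_eq]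
    have e : ∀ H, (SignType.sign (form W (mapHyp w H) (w.1 v)) =
        SignType.sign (form W (mapHyp w H) (w.1 p))) ↔
        SignType.sign (form W H v) = x.sign H := by
      intro H
      obtain ⟨c, hc, hcv⟩ := form_mapHyp w H
      rw [hcv, hcv, _root_.sign_mul, _root_.sign_mul, ← hp H]
      exact mul_right_inj' (sign_ne_zero.2 hc)
    constructor
    · intro h H
      exact (e H).1 (h _)
    · intro h H
      have := (e (mapHyp w⁻¹ H)).2 (h _)
      rwa [mapHyp_inv] at this
  ext u
  constructor
  · rintro ⟨v, hv, rfl⟩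
    exact (key v).2 hv
  · intro hu
    refine ⟨w.1.symm u, (key _).1 ?_, LinearEquiv.apply_symm_apply _ _⟩
    rwa [LinearEquiv.apply_symm_apply]

/-- `W` acts on faces by taking images. -/
instance : MulAction W (Face W) where
  smul w x := ⟨w.1 '' x.1, image_isFace w x⟩
  one_smul x := Subtype.ext (by
    change (fun v => v) '' x.1 = x.1
    simp)
  mul_smul w u x := Subtype.ext (by
    change (fun v => w.1 (u.1 v)) '' x.1 = w.1 '' (u.1 '' x.1)
    rw [Set.image_image])

lemma Face.coe_smul (w : W) (x : Face W) : (w • x).1 = w.1 '' x.1 := rfl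

lemma Face.sign_smul (w : W) (H : arrangement W) :
    ∃ τ : SignType, τ ≠ 0 ∧ ∀ x : Face W, (w • x).sign (mapHyp w H) = τ * x.sign H := by
  obtain ⟨c, hc, hcv⟩ := form_mapHyp w H
  refine ⟨SignType.sign c, sign_ne_zero.2 hc, fun x => ?_⟩
  obtain ⟨p, hp⟩ := x.2.1
  have h1 : w.1 p ∈ (w • x).1 := ⟨p, hp, rfl⟩
  rw [Face.sign_eq h1, Face.sign_eq hp, hcv, _root_.sign_mul]

instance [Finite W] : MulDistribMulAction W (Face W) where
  smul_mul w x y := Face.ext_sign <| by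
    funext H
    rw [← mapHyp_inv w H]
    obtain ⟨τ, hτ, h⟩ := Face.sign_smul w (mapHyp w⁻¹ H)
    simp only [Face.sign_mul, h]
    by_cases hx : x.sign (mapHyp w⁻¹ H) = 0 <;> simp [hx, hτ]
  smul_one w := Face.ext_sign <| by
    funext H
    rw [← mapHyp_inv w H]
    obtain ⟨τ, hτ, h⟩ := Face.sign_smul w (mapHyp w⁻¹ H)
    simp [h, Face.sign_one]

/-! ### Supports, the intersection lattice and its orbit poset -/

/-- The support of a face: the intersection of the hyperplanes that contain it. -/
def Face.supp (x : Face W) : Submodule ℝ V :=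
  sInf {H | H ∈ arrangement W ∧ x.1 ⊆ (H : Set V)}

lemma Face.supp_smul (w : W) (x : Face W) :
    (w • x).supp = x.supp.map ((w : V ≃ₗ[ℝ] V) : V →ₗ[ℝ] V) := by
  have hle : ∀ (w : W) (x : Face W),
      x.supp.map ((w : V ≃ₗ[ℝ] V) : V →ₗ[ℝ] V) ≤ (w • x).supp := by
    intro w x
    refine le_sInf ?_
    rintro H ⟨hH, hx⟩
    rw [Submodule.map_le_iff_le_comap]
    refine sInf_le ⟨?_, fun v hv => hx ⟨v, hv, rfl⟩⟩
    have := map_mem_arrangement w⁻¹ hH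
    convert this using 1
    exact (Submodule.map_equiv_eq_comap_symm (w.1.symm) H).symm
  refine le_antisymm ?_ (hle w x)
  have h := hle w⁻¹ (w • x)
  rw [inv_smul_smul] at h
  intro v hv
  refine ⟨w.1.symm v, h ⟨v, hv, rfl⟩, LinearEquiv.apply_symm_apply w.1 v⟩

variable (W)

/-- The intersection lattice `ℒ`: the set of supports of faces, ordered by inclusion. -/
abbrev Flat : Type _ := {X : Submodule ℝ V // ∃ x : Face W, x.supp = X}

variable {W}

instance [Finite W] : Finite (Flat W) :=
  Finite.of_surjective (fun x : Face W => (⟨x.supp, x, rfl⟩ : Flat W))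
    (by rintro ⟨_, x, rfl⟩; exact ⟨x, rfl⟩)

/-- `W` acts on `ℒ` by taking images. -/
instance : MulAction W (Flat W) where
  smul w X := ⟨X.1.map ((w : V ≃ₗ[ℝ] V) : V →ₗ[ℝ] V), by
    obtain ⟨x, hx⟩ := X.2
    exact ⟨w • x, by rw [Face.supp_smul, hx]⟩⟩
  one_smul X := Subtype.ext (Submodule.map_id X.1)
  mul_smul w u X := Subtype.ext
    (Submodule.map_comp ((u : V ≃ₗ[ℝ] V) : V →ₗ[ℝ] V) ((w : V ≃ₗ[ℝ] V) : V →ₗ[ℝ] V) X.1)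

lemma Flat.coe_smul (w : W) (X : Flat W) :
    (w • X).1 = X.1.map ((w : V ≃ₗ[ℝ] V) : V →ₗ[ℝ] V) := rfl

variable (W)

/-- `ℒ/W`, the set of `W`-orbits in the intersection lattice. -/
def FlatOrbit : Type _ := MulAction.orbitRel.Quotient W (Flat W)

variable {W}

/-- The orbit `𝒪_X` of `X`. -/
def Flat.orbit (X : Flat W) : FlatOrbit W := Quotient.mk _ X

lemma Flat.orbit_eq_iff {X Y : Flat W} : X.orbit = Y.orbit ↔ ∃ w : W, w • X = Y :=
  eq_comm.trans Quotient.eq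

instance [Finite W] : Finite (FlatOrbit W) := Quotient.finite _

/-- `𝒪_X ≤ 𝒪_Y` if and only if `w(X) ≤ Y` for some `w ∈ W` (see `Flat.orbit_le_iff`). -/
instance : LE (FlatOrbit W) where
  le P Q := ∃ X Y : Flat W, X.orbit = P ∧ Y.orbit = Q ∧ X ≤ Y

lemma Flat.smul_le_smul (w : W) {X Y : Flat W} (h : X ≤ Y) : w • X ≤ w • Y :=
  Submodule.map_mono (show X.1 ≤ Y.1 from h)

lemma Flat.orbit_le_iff {X Y : Flat W} : X.orbit ≤ Y.orbit ↔ ∃ w : W, w • X ≤ Y := by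
  constructor
  · rintro ⟨X', Y', hX, hY, h⟩
    obtain ⟨u, rfl⟩ := Flat.orbit_eq_iff.1 hX.symm
    obtain ⟨v, rfl⟩ := Flat.orbit_eq_iff.1 hY
    exact ⟨v * u, by rw [mul_smul]; exact Flat.smul_le_smul v h⟩
  · rintro ⟨w, h⟩
    exact ⟨w • X, Y, (Flat.orbit_eq_iff.2 ⟨w, rfl⟩).symm, rfl, h⟩

lemma Flat.finrank_smul (w : W) (X : Flat W) :
    Module.finrank ℝ (w • X).1 = Module.finrank ℝ X.1 :=
  LinearEquiv.finrank_map_eq (w : V ≃ₗ[ℝ] V) X.1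

instance [FiniteDimensional ℝ V] : PartialOrder (FlatOrbit W) where
  le_refl P := Quotient.inductionOn P fun X => ⟨X, X, rfl, rfl, le_rfl⟩
  le_trans P Q R := by
    refine Quotient.inductionOn₃ P Q R fun X Y Z => ?_
    change Flat.orbit X ≤ Flat.orbit Y → Flat.orbit Y ≤ Flat.orbit Z →
      Flat.orbit X ≤ Flat.orbit Z
    simp only [Flat.orbit_le_iff]
    rintro ⟨u, hu⟩ ⟨v, hv⟩
    exact ⟨v * u, by rw [mul_smul]; exact (Flat.smul_le_smul v hu).trans hv⟩
  le_antisymm P Q := by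
    refine Quotient.inductionOn₂ P Q fun X Y => ?_
    change Flat.orbit X ≤ Flat.orbit Y → Flat.orbit Y ≤ Flat.orbit X →
      Flat.orbit X = Flat.orbit Y
    simp only [Flat.orbit_le_iff, Flat.orbit_eq_iff]
    rintro ⟨u, hu⟩ ⟨v, hv⟩
    refine ⟨u, Subtype.ext (Submodule.eq_of_le_of_finrank_le hu ?_)⟩
    rw [Flat.finrank_smul, ← Flat.finrank_smul v Y]
    exact Submodule.finrank_mono (show (v • Y).1 ≤ X.1 from hv)

/-! ### The face semigroup algebra, its invariants and its idempotents -/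

section FaceAlgebra

variable (k : Type*) [Field k] (W) [Finite W]

/-- The face semigroup algebra `kℱ`. -/
abbrev FaceAlgebra : Type _ := MonoidAlgebra k (Face W)

/-- The linear extension to `kℱ` of the action of `w` on faces. -/
def act (w : W) : FaceAlgebra W k →ₐ[k] FaceAlgebra W k :=
  MonoidAlgebra.mapDomainAlgHom k k (MulDistribMulAction.toMonoidHom (Face W) w)

/-- The invariant subalgebra `(kℱ)^W`. -/
def invariantSubalgebra : Subalgebra k (FaceAlgebra W k) where
  carrier := {a | ∀ w : W, act W k w a = a}
  mul_mem' ha hb w := by rw [map_mul, ha w, hb w]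
  add_mem' ha hb w := by rw [map_add, ha w, hb w]
  algebraMap_mem' r w := AlgHom.commutes _ r

variable {W k}

/-- A family `ℓ_X` (`X ∈ ℒ`), where `ℓ_X` is a linear combination of faces of support `X` with
coefficients summing to `1`, such that `w(ℓ_X) = ℓ_{w(X)}`. -/
def IsInvariantFamily (l : Flat W → FaceAlgebra W k) : Prop :=
  (∀ X, ∀ x ∈ (l X).coeff.support, x.supp = X.1) ∧
  (∀ X, ((l X).coeff.sum fun _ a => a) = 1) ∧
  ∀ (w : W) (X : Flat W), act W k w (l X) = l (w • X)

/-- The elements `e_X = ℓ_X - ∑_{Y > X} ℓ_X e_Y`, by recursion downwards in `ℒ`. -/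
def idem (l : Flat W → FaceAlgebra W k) (X : Flat W) : FaceAlgebra W k :=
  letI : Fintype {Y : Flat W // X < Y} := Fintype.ofFinite _
  l X - ∑ Y : {Y : Flat W // X < Y}, l X * idem l Y.1
termination_by wellFounded_gt.wrap X
decreasing_by exact Y.2

lemma idem_eq (l : Flat W → FaceAlgebra W k) (X : Flat W) [Fintype {Y : Flat W // X < Y}] :
    idem l X = l X - ∑ Y : {Y : Flat W // X < Y}, l X * idem l Y.1 := by
  rw [idem]
  congr!

/-- The element `ε_𝒪 = ∑_{X ∈ 𝒪} e_X` of `kℱ`. -/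
def orbitIdem (l : Flat W → FaceAlgebra W k) (P : FlatOrbit W) : FaceAlgebra W k :=
  letI : Fintype {X : Flat W // X.orbit = P} := Fintype.ofFinite _
  ∑ X : {X : Flat W // X.orbit = P}, idem l X.1

end FaceAlgebra

/-! ### Chambers, simple reflections and the descent algebra -/

section Descent

variable (W)

/-- A chamber: a connected component of the complement of the union of the hyperplanes. -/
def IsChamber [TopologicalSpace V] (c : Set V) : Prop :=
  ∃ v ∈ (⋃ H ∈ arrangement W, (H : Set V))ᶜ,
    c = connectedComponentIn (⋃ H ∈ arrangement W, (H : Set V))ᶜ v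

/-- A wall of `c`: a hyperplane `H` of the arrangement such that `H ∩ closure c` spans `H`. -/
def IsWall [TopologicalSpace V] (c : Set V) (H : Submodule ℝ V) : Prop :=
  H ∈ arrangement W ∧ Submodule.span ℝ ((H : Set V) ∩ closure c) = H

/-- The set `S ⊆ W` of reflections in the walls of `c`. -/
def simpleReflections [TopologicalSpace V] (c : Set V) : Set W :=
  {s | IsReflection s.1 ∧ IsWall W c (fixedSpace s.1)}

end Descent

end Arrangement

section DescentAlgebra

variable {G : Type*} [Group G]

/-- The length of `w` with respect to a generating set `S`: the least number of factors in an
expression of `w` as a product of elements of `S`. -/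
def length (S : Set G) (w : G) : ℕ :=
  sInf {n | ∃ l : List G, (∀ s ∈ l, s ∈ S) ∧ l.prod = w ∧ l.length = n}

/-- `X_J`: the elements `w` that have minimal length in their coset `w W_J`. -/
def minimalReps (S J : Set G) : Set G :=
  {w | ∀ u ∈ Subgroup.closure J, length S w ≤ length S (w * u)}

variable (k : Type*) [Field k] [Finite G]

/-- `x_J = ∑_{w ∈ X_J} w` in the group algebra. -/
def descentElement (S J : Set G) : MonoidAlgebra k G :=
  ∑ w ∈ (Set.toFinite (minimalReps S J)).toFinset, MonoidAlgebra.single w 1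

/-- `D` is the descent algebra with respect to `S`: the subalgebra of the group algebra whose
underlying vector space is the span of the elements `x_J`, `J ⊆ S`. -/
def IsDescentAlgebra (S : Set G) (D : Subalgebra k (MonoidAlgebra k G)) : Prop :=
  Subalgebra.toSubmodule D = Submodule.span k {x | ∃ J ⊆ S, x = descentElement k S J}

end DescentAlgebra

end FaceAlg

end

open FaceAlg

/-!
The algebra `A = (kℱ)^W` carries a *triangular system* of idempotents: orthogonal elements `ε_𝒪`
with sum `1`, indexed by the finite poset `ℒ/W`, such that `ε_𝒪 A ε_𝒪'` vanishes unless `𝒪 ≤ 𝒪'`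
and `ε_𝒪 A ε_𝒪 = k ε_𝒪` (`IsInvariantFamily.isTriangular`). All assertions about `A` are formal
consequences.

* Reading off the diagonal is an algebra homomorphism `A → k^(ℒ/W)` with nil kernel, so the kernel
  is the radical and `A` is split basic. The `ε_𝒪` are primitive, and `ε_𝒪 (rad A) ε_𝒪' ≠ 0` forces
  `𝒪 < 𝒪'`. Idempotents lift along a homomorphism with nil kernel, so any primitive idempotent is
  congruent to some `ε_𝒪` modulo the radical. The arrows between two idempotents depend only on
  their classes modulo the radical, so the quiver of any complete system is acyclic
  (`IsTriangular.noOrientedCycles`).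
* If `ε` is the sum of the `ε_𝒪` over an upper set, then `A ε` is a two-sided ideal. Adding one
  index at a time along a linear extension of the order gives a chain of ideals whose successive
  quotients are generated, as left ideals, by the image `e` of a single idempotent, and `B e` is
  projective (`IsTriangular.isQuasiHereditary`).

The triangular system comes from the idempotents `e_X` of `kℱ`. The main point is that a face whose
support is not contained in `X` annihilates `e_X` (`IsInvariantFamily.single_mul_idem`); it follows
that the `e_X` are orthogonal with sum `1`, that `e_X kℱ e_Y = 0` unless `X ≤ Y`, and that
`e_X a e_X = χ_X(a) e_X` for the character `χ_X` of `kℱ` which is `1` on the faces with support in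
`X` and `0` on the others.

For the descent algebra, fix a chamber `C`. The group acts simply transitively on the chambers, so
`a * C` can be read as an element of `kW` for every `a ∈ kℱ`, and on invariants this is an
anti-homomorphism `A → kW` (`projMap_mul`). It sends the sum of the `W`-orbit of a face `x` of `C`
to `x_J`, where `J` is the set of simple reflections that fix `x`, because `w` has minimal length in
`w⟨J⟩` exactly if `(w x) * C = w C` (`Face.mem_minimalReps_iff`). So its image is the descent
algebra. A surjective anti-homomorphism carries a triangular system to a triangular system for the
reversed order (members may become zero, which is harmless), so the descent algebra is
quasi-hereditary as well; injectivity is not needed.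

The facts about reflection groups used here are derived from the sign vectors of faces. A chamber is
cut out by its walls, a chamber and its mirror image in a wall are separated by this wall only, and
these give the exchange property (`Face.exchange`) by induction on words. Generation by the simple
reflections, freeness of the action on chambers and the equality of the length of `w` with the
number of hyperplanes separating `C` from `w C` follow from it.
-/

noncomputable section

namespace FaceAlg

/-! ### Triangular systems of idempotents -/

section Triangular

variable {k A I : Type*} [Field k] [Ring A] [Algebra k A] [Fintype I] [PartialOrder I]

/-- A family `ε` of orthogonal elements with sum `1`, indexed by a finite poset, such that
`ε i * A * ε j` vanishes unless `i ≤ j` and `ε i * A * ε i` is spanned by `ε i`. -/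
structure IsTriangular (k : Type*) [Field k] {A I : Type*} [Ring A] [Algebra k A] [Fintype I]
    [PartialOrder I] (ε : I → A) : Prop where
  sum_eq_one : ∑ i, ε i = 1
  mul_eq_zero : ∀ i j, i ≠ j → ε i * ε j = 0
  mul_mul_eq_zero : ∀ i j a, ¬ i ≤ j → ε i * a * ε j = 0
  exists_smul : ∀ i a, ∃ c : k, ε i * a * ε i = c • ε i

variable {ε : I → A}

lemma IsTriangular.mul_self (h : IsTriangular k ε) (i : I) : ε i * ε i = ε i := by
  classical
  have h1 : ε i * ∑ j, ε j = ε i := by rw [h.sum_eq_one, mul_one]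
  rwa [Finset.mul_sum, Finset.sum_eq_single i (fun j _ hj => h.mul_eq_zero i j hj.symm)
    (by simp)] at h1

lemma IsTriangular.mul_eq_sum (h : IsTriangular k ε) (a b : A) :
    a * b = ∑ i, a * ε i * b := by
  rw [← Finset.sum_mul, ← Finset.mul_sum, h.sum_eq_one, mul_one]

/-- The diagonal is multiplicative: in `∑ j, ε i * a * ε j * b * ε i` only the terms with
`i ≤ j ≤ i` survive. -/
lemma IsTriangular.mul_mul_mul (h : IsTriangular k ε) (i : I) (a b : A) :
    ε i * (a * b) * ε i = ε i * a * ε i * (ε i * b * ε i) := by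
  classical
  rw [← mul_assoc, h.mul_eq_sum (ε i * a) b, Finset.sum_mul, Finset.sum_eq_single i]
  · conv_rhs => rw [mul_assoc (ε i * a), ← mul_assoc (ε i), ← mul_assoc (ε i), h.mul_self]
    simp only [mul_assoc]
  · intro j _ hj
    by_cases h1 : i ≤ j
    · have h2 : ¬ j ≤ i := fun h2 => hj (le_antisymm h2 h1)
      rw [mul_assoc, mul_assoc, ← mul_assoc (ε j), h.mul_mul_eq_zero j i b h2, mul_zero]
    · rw [h.mul_mul_eq_zero i j a h1, zero_mul, zero_mul]
  · simp

/-- The scalar by which `ε i * a * ε i` is a multiple of `ε i`. -/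
def IsTriangular.diag (h : IsTriangular k ε) (a : A) (i : I) : k := (h.exists_smul i a).choose

lemma IsTriangular.diag_smul (h : IsTriangular k ε) (a : A) (i : I) :
    h.diag a i • ε i = ε i * a * ε i := (h.exists_smul i a).choose_spec.symm

lemma IsTriangular.diag_eq (h : IsTriangular k ε) {a : A} {i : I} (hi : ε i ≠ 0) {c : k}
    (hc : ε i * a * ε i = c • ε i) : h.diag a i = c :=
  smul_left_injective k hi ((h.diag_smul a i).trans hc)

/-- The algebra homomorphism `A → k^I` reading off the diagonal of a triangular system. -/
def IsTriangular.diagHom (h : IsTriangular k ε) (h0 : ∀ i, ε i ≠ 0) : A →ₐ[k] (I → k) where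
  toFun := h.diag
  map_one' := funext fun i => h.diag_eq (h0 i) (by simp [h.mul_self])
  map_mul' a b := funext fun i => h.diag_eq (h0 i) (by
    rw [h.mul_mul_mul, ← h.diag_smul a, ← h.diag_smul b, smul_mul_smul_comm, h.mul_self]
    rfl)
  map_zero' := funext fun i => h.diag_eq (h0 i) (by simp)
  map_add' a b := funext fun i => h.diag_eq (h0 i) (by
    rw [mul_add, add_mul, ← h.diag_smul a, ← h.diag_smul b, Pi.add_apply, add_smul])
  commutes' c := funext fun i => h.diag_eq (h0 i) (by
    rw [Algebra.algebraMap_eq_smul_one, mul_smul_comm, mul_one, smul_mul_assoc, h.mul_self]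
    rfl)

lemma IsTriangular.diagHom_apply (h : IsTriangular k ε) (h0 : ∀ i, ε i ≠ 0) (a : A) (i : I) :
    h.diagHom h0 a i • ε i = ε i * a * ε i := h.diag_smul a i

lemma IsTriangular.diagHom_idem [DecidableEq I] (h : IsTriangular k ε) (h0 : ∀ i, ε i ≠ 0)
    (i : I) : h.diagHom h0 (ε i) = Pi.single i 1 := by
  funext j
  refine h.diag_eq (h0 j) ?_
  by_cases hij : j = i
  · subst hij
    simp [h.mul_self]
  · simp [h.mul_eq_zero j i hij, hij]

lemma IsTriangular.diagHom_surjective (h : IsTriangular k ε) (h0 : ∀ i, ε i ≠ 0) :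
    Function.Surjective (h.diagHom h0) := by
  classical
  intro f
  refine ⟨∑ i, f i • ε i, ?_⟩
  rw [map_sum]
  funext j
  simp [h.diagHom_idem h0, Pi.single_apply]

/-- An element with zero diagonal is strictly triangular, hence nilpotent. -/
lemma IsTriangular.isNilpotent_of_diagHom (h : IsTriangular k ε) (h0 : ∀ i, ε i ≠ 0) {x : A}
    (hx : h.diagHom h0 x = 0) : IsNilpotent x := by
  have key : ∀ j, ∃ n, ∀ m ≥ n, x ^ m * ε j = 0 := by
    intro j
    induction j using WellFoundedLT.induction with
    | ind j ih =>
      choose! n hn using ih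
      refine ⟨(∑ i, n i) + 1, fun m hm => ?_⟩
      obtain ⟨m, rfl⟩ : ∃ p, m = p + 1 := ⟨m - 1, by omega⟩
      rw [pow_succ, mul_assoc, h.mul_eq_sum]
      refine Finset.sum_eq_zero fun i _ => ?_
      by_cases hij : i < j
      · have : n i ≤ ∑ i, n i := Finset.single_le_sum (fun _ _ => Nat.zero_le _) (Finset.mem_univ i)
        rw [hn i hij m (by omega), zero_mul]
      · have : ε i * x * ε j = 0 := by
          by_cases hij' : i = j
          · subst hij'
            rw [← h.diagHom_apply h0, hx]
            simp
          · exact h.mul_mul_eq_zero i j x fun hle => hij (lt_of_le_of_ne hle hij')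
        rw [mul_assoc, ← mul_assoc (ε i), this, mul_zero]
  choose n hn using key
  refine ⟨∑ i, n i, ?_⟩
  rw [← mul_one (x ^ _), ← h.sum_eq_one, Finset.mul_sum]
  exact Finset.sum_eq_zero fun j _ =>
    hn j _ (Finset.single_le_sum (fun _ _ => Nat.zero_le _) (Finset.mem_univ j))

lemma IsTriangular.mem_jacobson_iff (h : IsTriangular k ε) (h0 : ∀ i, ε i ≠ 0) {x : A} :
    x ∈ Ring.jacobson A ↔ h.diagHom h0 x = 0 := by
  constructor
  · intro hx
    have : RingHomSurjective (h.diagHom h0).toRingHom := ⟨h.diagHom_surjective h0⟩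
    have := Ring.le_comap_jacobson (h.diagHom h0).toRingHom hx
    rw [IsSemisimpleRing.jacobson_eq_bot] at this
    exact this
  · intro hx
    rw [← Ideal.jacobson_bot, Ideal.mem_jacobson_iff]
    intro y
    have hn : IsNilpotent (y * x) := h.isNilpotent_of_diagHom h0 (by rw [map_mul, hx, mul_zero])
    obtain ⟨z, hz⟩ := hn.isUnit_one_add.exists_left_inv
    refine ⟨z, ?_⟩
    rw [Submodule.mem_bot, sub_eq_zero, mul_assoc, ← hz]
    noncomm_ring

lemma IsTriangular.isSplitBasic (h : IsTriangular k ε) (h0 : ∀ i, ε i ≠ 0) :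
    IsSplitBasic k A := by
  have hker : RingHom.ker (h.diagHom h0) = Ring.jacobson A := by
    ext x
    rw [RingHom.mem_ker, h.mem_jacobson_iff h0]
  refine ⟨Fintype.card I, ⟨?_⟩⟩
  exact ((Ideal.quotientEquivAlgOfEq k hker).symm.trans
    (Ideal.quotientKerAlgEquivOfSurjective (h.diagHom_surjective h0))).trans
    (AlgEquiv.piCongrLeft' k (fun _ => k) (Fintype.equivFin I))

lemma IsTriangular.isPrimitiveIdempotent (h : IsTriangular k ε) {i : I} (h0 : ε i ≠ 0) :
    IsPrimitiveIdempotent (ε i) := by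
  refine ⟨h.mul_self i, h0, fun f g hf hg hfg hgf he => ?_⟩
  obtain ⟨c, hc⟩ := h.exists_smul i f
  have h1 : ε i * f * ε i = f := by
    simp only [he, add_mul, mul_add, hf.eq, hfg, hgf, add_zero]
  rw [h1] at hc
  have h2 : (c * c) • ε i = c • ε i := by
    rw [← hc]
    conv_rhs => rw [← hf.eq, hc, smul_mul_smul_comm, h.mul_self]
  have h3 : c * c = c := smul_left_injective k h0 h2
  rcases IsIdempotentElem.iff_eq_zero_or_one.1 h3 with h4 | h4
  · left
    rw [hc, h4, zero_smul]
  · right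
    rw [h4, one_smul] at hc
    rw [hc] at he
    exact left_eq_add.1 he

lemma IsTriangular.isCompleteSystem (h : IsTriangular k ε) (h0 : ∀ i, ε i ≠ 0) :
    IsCompleteSystem ε := by
  refine ⟨fun i => h.isPrimitiveIdempotent (h0 i), h.mul_eq_zero, ?_⟩
  rw [← h.sum_eq_one]
  congr!

/-! ### Arrows of the quiver -/

lemma mem_arrowSpace {f e : A} {z : A ⧸ (radical k A * radical k A)} :
    z ∈ arrowSpace k f e ↔
      ∃ r ∈ Ring.jacobson A, (radical k A * radical k A).mkQ (f * r * e) = z := by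
  constructor
  · rintro ⟨_, ⟨r, hr, rfl⟩, rfl⟩
    exact ⟨r, hr, by rw [mul_assoc]; rfl⟩
  · rintro ⟨r, hr, rfl⟩
    exact ⟨_, ⟨r, hr, rfl⟩, by rw [mul_assoc]; rfl⟩

/-- The space of arrows only depends on the idempotents modulo the radical. -/
lemma arrowSpace_congr {f e f' e' : A} (hf : f - f' ∈ Ring.jacobson A)
    (he : e - e' ∈ Ring.jacobson A) : arrowSpace k f e = arrowSpace k f' e' := by
  have key : ∀ r ∈ Ring.jacobson A, (radical k A * radical k A).mkQ (f * r * e) =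
      (radical k A * radical k A).mkQ (f' * r * e') := by
    intro r hr
    rw [← sub_eq_zero, ← map_sub, Submodule.mkQ_apply, Submodule.Quotient.mk_eq_zero]
    have : f * r * e - f' * r * e' = (f - f') * (r * e) + (f' * r) * (e - e') := by noncomm_ring
    rw [this]
    refine add_mem (Submodule.mul_mem_mul hf ?_) (Submodule.mul_mem_mul ?_ he)
    · exact Ideal.mul_mem_right _ _ hr
    · exact Ideal.mul_mem_left _ _ hr
  ext z
  rw [mem_arrowSpace, mem_arrowSpace]
  constructor
  · rintro ⟨r, hr, rfl⟩
    exact ⟨r, hr, (key r hr).symm⟩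
  · rintro ⟨r, hr, rfl⟩
    exact ⟨r, hr, key r hr⟩

lemma arrowSpace_ne_bot {J : Type*} {e : J → A} {x y : J}
    (hxy : Nonempty ((quiverOf k e).Hom x y)) : arrowSpace k (e y) (e x) ≠ ⊥ := by
  intro hb
  obtain ⟨a⟩ := hxy
  have a' : Fin (Module.finrank k (arrowSpace k (e y) (e x))) := a
  rw [hb, finrank_bot] at a'
  exact a'.elim0

lemma IsTriangular.lt_of_arrowSpace_ne_bot (h : IsTriangular k ε) (h0 : ∀ i, ε i ≠ 0) {i j : I}
    (hne : arrowSpace k (ε i) (ε j) ≠ ⊥) : i < j := by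
  by_contra hij
  refine hne (eq_bot_iff.2 fun z hz => ?_)
  obtain ⟨r, hr, rfl⟩ := mem_arrowSpace.1 hz
  have : ε i * r * ε j = 0 := by
    by_cases hij' : i = j
    · subst hij'
      rw [← h.diagHom_apply h0, (h.mem_jacobson_iff h0).1 hr]
      simp
    · exact h.mul_mul_eq_zero i j r fun hle => hij (lt_of_le_of_ne hle hij')
  rw [this, map_zero]
  exact zero_mem _

/-- Idempotents lift along `A → k^I` because its kernel is nil; so the image of a primitive
idempotent is the indicator of a single index. -/
lemma IsTriangular.exists_sub_mem_jacobson (h : IsTriangular k ε) (h0 : ∀ i, ε i ≠ 0) {e : A}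
    (he : IsPrimitiveIdempotent e) : ∃ i, e - ε i ∈ Ring.jacobson A := by
  classical
  obtain ⟨hi, hne, hprim⟩ := he
  set φ := h.diagHom h0
  have hφ : ∀ p, φ e p = 0 ∨ φ e p = 1 := fun p => by
    have : φ e p * φ e p = φ e p := by
      rw [← Pi.mul_apply, ← map_mul, hi.eq]
    exact IsIdempotentElem.iff_eq_zero_or_one.1 this
  have hex : ∃ p, φ e p = 1 := by
    by_contra! hcon
    have hz : φ e = 0 := funext fun p => (hφ p).resolve_right (hcon p)
    obtain ⟨n, hn⟩ := h.isNilpotent_of_diagHom h0 hz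
    refine hne ?_
    rcases Nat.eq_zero_or_pos n with rfl | hpos
    · rw [← mul_one e, ← pow_zero e, hn, mul_zero]
    · rw [← hi.pow_eq hpos.ne', hn]
  obtain ⟨p, hp⟩ := hex
  refine ⟨p, ?_⟩
  -- an idempotent lift of the indicator of `p` that is orthogonal to `1 - e`, so that `f` is a
  -- summand of `e`
  obtain ⟨f, hf, hfp, hfe, hef⟩ := exists_isIdempotentElem_mul_eq_zero_of_ker_isNilpotent
    (φ : A →+* (I → k)) (fun x hx => h.isNilpotent_of_diagHom h0 hx) (Pi.single p 1)
    ((h.diagHom_surjective h0) _) (by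
      rw [IsIdempotentElem, ← Pi.single_mul, mul_one]) (1 - e) hi.one_sub
    (by
      funext q
      by_cases hq : q = p
      · subst hq; simp [hp]
      · simp [hq]) (by
      funext q
      by_cases hq : q = p
      · subst hq; simp [hp]
      · simp [hq])
  rw [mul_sub, mul_one, sub_eq_zero] at hfe
  rw [sub_mul, one_mul, sub_eq_zero] at hef
  have hfn : f ≠ 0 := by
    rintro rfl
    have := congrFun hfp p
    simp at this
  have h1 := hprim f (e - f) hf
    (by rw [IsIdempotentElem, mul_sub, sub_mul, sub_mul, hi.eq, ← hfe, ← hef, hf.eq]; simp)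
    (by rw [mul_sub, ← hfe, hf.eq, sub_self]) (by rw [sub_mul, ← hef, hf.eq, sub_self])
    (by abel)
  have h2 : e = f := sub_eq_zero.1 (h1.resolve_left hfn)
  rw [h.mem_jacobson_iff h0, map_sub, h.diagHom_idem h0, h2, sub_eq_zero]
  exact hfp

/-- The members of a complete system are congruent to members of the triangular system, and arrows
strictly decrease the index of the latter. -/
lemma IsTriangular.noOrientedCycles (h : IsTriangular k ε) (h0 : ∀ i, ε i ≠ 0) {J : Type*}
    [Finite J] {e : J → A} (he : IsCompleteSystem e) : NoOrientedCycles (quiverOf k e) := by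
  choose p hp using fun j => h.exists_sub_mem_jacobson h0 (he.1 j)
  let _ := quiverOf k e
  have harr : ∀ {x y : J}, (x ⟶ y) → p y < p x := fun {x y} a => by
    refine h.lt_of_arrowSpace_ne_bot h0 ?_
    rw [← arrowSpace_congr (hp y) (hp x)]
    exact arrowSpace_ne_bot ⟨a⟩
  have hpath : ∀ {x y : J} (q : Quiver.Path x y), q.length ≠ 0 → p y < p x := by
    intro x y q
    induction q with
    | nil => intro h; exact absurd rfl h
    | cons q a ih =>
      intro _
      by_cases hq : q.length = 0
      · rw [Quiver.Path.eq_of_length_zero q hq]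
        exact harr a
      · exact (harr a).trans (ih hq)
  intro v q
  by_contra hq
  exact lt_irrefl _ (hpath q hq)

/-! ### Heredity chains -/

/-- A left ideal `B * f` with `f * B = f * B * f` and `f * rad B * f = 0` is a heredity ideal; it is
projective, being a direct summand of `B`. -/
lemma isHeredityIdeal_span {B : Type*} [Ring B] {f : B} (hf : f * f = f)
    (hB : ∀ b, f * b = f * b * f) (hrad : ∀ r ∈ Ring.jacobson B, f * r * f = 0) :
    IsHeredityIdeal (Ideal.span {f}) := by
  have hmem : ∀ {x}, x ∈ Ideal.span {f} ↔ x * f = x := fun {x} => by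
    rw [Ideal.mem_span_singleton']
    constructor
    · rintro ⟨a, rfl⟩
      rw [mul_assoc, hf]
    · exact fun h => ⟨x, h⟩
  refine ⟨⟨fun {x} b hx => ?_⟩, le_antisymm ?_ ?_, fun a ha r hr b hb => ?_, ?_⟩
  · rw [hmem] at hx ⊢
    rw [← hx, mul_assoc x, mul_assoc, ← hB]
  · exact Ideal.mul_le_right
  · rw [Ideal.span_le, Set.singleton_subset_iff, SetLike.mem_coe]
    have := Ideal.mul_mem_mul (Ideal.mem_span_singleton_self f) (Ideal.mem_span_singleton_self f)
    rwa [hf] at this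
  · rw [← hmem.1 ha, ← hmem.1 hb]
    have : a * f * r * (b * f) = a * (f * (r * b) * f) := by noncomm_ring
    rw [this, hrad _ (Ideal.mul_mem_right _ _ hr), mul_zero]
  · refine Module.Projective.of_split (Ideal.span {f}).subtype
      ((LinearMap.toSpanSingleton B B f).codRestrict _ fun b => ?_) ?_
    · rw [hmem, LinearMap.toSpanSingleton_apply, smul_eq_mul, mul_assoc, hf]
    · ext x
      simpa using hmem.1 x.2

lemma eq_zero_of_mem_jacobson {B : Type*} [Ring B] {e : B} (he : e * e = e)
    (hr : e ∈ Ring.jacobson B) : e = 0 := by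
  rw [← Ideal.jacobson_bot, Ideal.mem_jacobson_iff] at hr
  obtain ⟨z, hz⟩ := hr (-1)
  rw [Submodule.mem_bot, sub_eq_zero] at hz
  rw [← one_mul e, ← hz]
  have : (z * -1 * e + z) * e = z * e - z * (e * e) := by noncomm_ring
  rw [this, he, sub_self]

section Chain

variable {n : ℕ} {η : Fin n → A}

/-- The sum of the last `t` members of a family indexed by `Fin n`. -/
def tailSum (η : Fin n → A) (t : ℕ) : A := ∑ i with n ≤ i.1 + t, η i

lemma tailSum_zero (η : Fin n → A) : tailSum η 0 = 0 := by
  rw [tailSum, Finset.filter_false_of_mem, Finset.sum_empty]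
  intro i _
  have := i.2
  omega

lemma tailSum_self (η : Fin n → A) : tailSum η n = ∑ i, η i := by
  rw [tailSum, Finset.filter_true_of_mem]
  intro i _
  omega

lemma tailSum_succ (η : Fin n → A) {t : ℕ} (ht : t < n) :
    tailSum η (t + 1) = η ⟨n - 1 - t, by omega⟩ + tailSum η t := by
  rw [tailSum, tailSum, ← Finset.sum_insert]
  · congr 1
    ext i
    simp only [Finset.mem_filter, Finset.mem_univ, true_and, Finset.mem_insert, Fin.ext_iff]
    omega
  · simp only [Finset.mem_filter, Finset.mem_univ, true_and]
    omega

lemma IsTriangular.tailSum_mul (h : IsTriangular k η) (t : ℕ) (a : A) :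
    tailSum η t * a * tailSum η t = tailSum η t * a := by
  classical
  conv_rhs => rw [← mul_one (_ * a), ← h.sum_eq_one]
  rw [tailSum, Finset.mul_sum, Finset.mul_sum, Finset.sum_filter]
  refine Finset.sum_congr rfl fun j _ => ?_
  split_ifs with hj
  · rfl
  · rw [Finset.sum_mul, Finset.sum_mul]
    refine (Finset.sum_eq_zero fun i hi => h.mul_mul_eq_zero i j a ?_).symm
    rw [Finset.mem_filter] at hi
    rw [Fin.le_def]
    omega

lemma IsTriangular.tailSum_mul_self (h : IsTriangular k η) (t : ℕ) :
    tailSum η t * tailSum η t = tailSum η t := by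
  simpa using h.tailSum_mul t 1

lemma IsTriangular.mem_span_tailSum (h : IsTriangular k η) {t : ℕ} {x : A} :
    x ∈ Ideal.span {tailSum η t} ↔ x * tailSum η t = x := by
  rw [Ideal.mem_span_singleton']
  constructor
  · rintro ⟨a, rfl⟩
    rw [mul_assoc, h.tailSum_mul_self]
  · exact fun h => ⟨x, h⟩

lemma IsTriangular.isTwoSided_span_tailSum (h : IsTriangular k η) (t : ℕ) :
    (Ideal.span {tailSum η t}).IsTwoSided := by
  refine ⟨fun {x} b hx => ?_⟩
  rw [h.mem_span_tailSum] at hx ⊢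
  rw [← hx, mul_assoc x, mul_assoc, h.tailSum_mul]

/-- The left ideals generated by the sums of the top `t` idempotents form a heredity chain. -/
lemma IsTriangular.isQuasiHereditary_fin (h : IsTriangular k η) (h0 : ∀ i, η i ≠ 0) :
    IsQuasiHereditary A := by
  refine ⟨n, fun t => Ideal.span {tailSum η t}, h.isTwoSided_span_tailSum, ?_, ?_, ?_⟩
  · beta_reduce
    rw [tailSum_zero, Ideal.span_singleton_eq_bot]
  · beta_reduce
    rw [tailSum_self, h.sum_eq_one, Ideal.span_singleton_one]
  intro t ht
  have hsucc := tailSum_succ η ht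
  set i : Fin n := ⟨n - 1 - t, by omega⟩ with hi
  have hti : tailSum η t * η i = 0 := by
    rw [tailSum, Finset.sum_mul]
    refine Finset.sum_eq_zero fun j hj => h.mul_eq_zero _ _ ?_
    rintro rfl
    simp only [Finset.mem_filter, Finset.mem_univ, true_and, hi] at hj
    omega
  have hit : η i * tailSum η t = 0 := by
    rw [tailSum, Finset.mul_sum]
    refine Finset.sum_eq_zero fun j hj => h.mul_eq_zero _ _ ?_
    rintro rfl
    simp only [Finset.mem_filter, Finset.mem_univ, true_and, hi] at hj
    omega
  have := h.isTwoSided_span_tailSum t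
  refine ⟨?_, ?_⟩
  · refine lt_of_le_of_ne ?_ fun heq => h0 i ?_
    · rw [Ideal.span_le, Set.singleton_subset_iff, SetLike.mem_coe, h.mem_span_tailSum, hsucc,
        mul_add, hti, h.tailSum_mul_self, zero_add]
    · have h1 : η i ∈ Ideal.span {tailSum η (t + 1)} := by
        rw [h.mem_span_tailSum, hsucc, mul_add, hit, h.mul_self, add_zero]
      rw [← show Ideal.span {tailSum η t} = Ideal.span {tailSum η (t + 1)} from heq,
        h.mem_span_tailSum, hit] at h1
      exact h1.symm
  · set π := Ideal.Quotient.mk (Ideal.span {tailSum η t})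
    have hπ : π (tailSum η (t + 1)) = π (η i) := by
      rw [hsucc, map_add, Ideal.Quotient.eq_zero_iff_mem.2 (Ideal.mem_span_singleton_self _),
        add_zero]
    rw [Ideal.map_span, Set.image_singleton]
    have hid : π (η i) * π (η i) = π (η i) := by rw [← map_mul, h.mul_self]
    refine isHeredityIdeal_span (by rw [hπ, hid]) (fun b => ?_) (fun r hr => ?_)
    · obtain ⟨a, rfl⟩ := Ideal.Quotient.mk_surjective b
      rw [← map_mul, ← map_mul, h.tailSum_mul]
    · obtain ⟨a, rfl⟩ := Ideal.Quotient.mk_surjective r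
      obtain ⟨c, hc⟩ := h.exists_smul i a
      have h1 : π (η i) * π a * π (η i) = π (algebraMap k A c) * π (η i) := by
        rw [← map_mul, ← map_mul, hc, Algebra.smul_def, map_mul]
      rw [hπ, h1]
      by_cases hc0 : c = 0
      · rw [hc0, map_zero, map_zero, zero_mul]
      -- a unit multiple of the idempotent `π (η i)` in the radical forces it to vanish
      rw [eq_zero_of_mem_jacobson hid, mul_zero]
      have h2 : π (η i) = π (algebraMap k A c⁻¹) * (π (η i) * π a * π (η i)) := by
        rw [h1, ← mul_assoc, ← map_mul, ← map_mul (algebraMap k A), inv_mul_cancel₀ hc0, map_one,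
          map_one, one_mul]
      rw [h2]
      exact Ideal.mul_mem_left _ _ (Ideal.mul_mem_right _ _ (Ideal.mul_mem_left _ _ hr))

end Chain

lemma exists_enumeration (J : Type*) [Fintype J] [PartialOrder J] :
    ∃ e : Fin (Fintype.card J) ≃ J, ∀ x y, e x ≤ e y → x ≤ y := by
  let _ : Fintype (LinearExtension J) := (inferInstance : Fintype J)
  let o : Fin (Fintype.card J) ≃o LinearExtension J :=
    Fintype.orderIsoFinOfCardEq (LinearExtension J) rfl
  exact ⟨o.toEquiv, fun x y hxy =>
    o.le_iff_le.1 ((toLinearExtension : J →o LinearExtension J).monotone hxy)⟩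

/-- An algebra with a triangular system of idempotents is quasi-hereditary: discard the members that
vanish and enumerate the others along a linear extension of the order. -/
lemma IsTriangular.isQuasiHereditary (h : IsTriangular k ε) : IsQuasiHereditary A := by
  classical
  obtain ⟨o, ho⟩ := exists_enumeration {i : I // ε i ≠ 0}
  refine IsTriangular.isQuasiHereditary_fin (k := k) (η := fun x => ε (o x).1)
    ⟨?_, ?_, ?_, ?_⟩ fun x => (o x).2
  · rw [o.sum_comp (fun y => ε y.1), ← h.sum_eq_one,
      ← Finset.sum_filter_ne_zero (f := ε) Finset.univ]
    exact (Finset.sum_subtype (p := fun i => ε i ≠ 0) {i | ε i ≠ 0} (fun i => by simp) ε).symm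
  · exact fun x y hxy => h.mul_eq_zero _ _ fun he => hxy (o.injective (Subtype.ext he))
  · exact fun x y a hxy => h.mul_mul_eq_zero _ _ _ fun hle => hxy (ho _ _ hle)
  · exact fun x a => h.exists_smul _ a

/-- Triangular systems pass, with the reversed order, along surjective anti-homomorphisms. -/
lemma IsTriangular.map_anti (h : IsTriangular k ε) {B : Type*} [Ring B] [Algebra k B]
    (f : A →ₗ[k] B) (hf1 : f 1 = 1) (hf : ∀ a b, f (a * b) = f b * f a)
    (hs : Function.Surjective f) :
    IsTriangular k (fun i : Iᵒᵈ => f (ε (OrderDual.ofDual i))) := by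
  refine ⟨?_, fun i j hij => ?_, fun i j b hij => ?_, fun i b => ?_⟩
  · rw [← hf1, ← h.sum_eq_one, map_sum]
    rfl
  · rw [← hf, h.mul_eq_zero (OrderDual.ofDual j) (OrderDual.ofDual i) fun he => hij he.symm,
      map_zero]
  · obtain ⟨a, rfl⟩ := hs b
    rw [← hf, ← hf, ← mul_assoc,
      h.mul_mul_eq_zero (OrderDual.ofDual j) (OrderDual.ofDual i) _ hij, map_zero]
  · obtain ⟨a, rfl⟩ := hs b
    obtain ⟨c, hc⟩ := h.exists_smul (OrderDual.ofDual i) a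
    exact ⟨c, by rw [← hf, ← hf, ← mul_assoc, hc, map_smul]⟩

end Triangular

/-! ### Faces and flats -/

section Flats

variable {V : Type*} [AddCommGroup V] [Module ℝ V] {W : Subgroup (V ≃ₗ[ℝ] V)}

lemma Face.sign_eq_zero_iff {x : Face W} {H : arrangement W} :
    x.sign H = 0 ↔ x.1 ⊆ (H.1 : Set V) := by
  have hmem : ∀ v, v ∈ (H.1 : Set V) ↔ SignType.sign (form W H v) = 0 := fun v => by
    rw [_root_.sign_eq_zero_iff, ← LinearMap.mem_ker, ker_form, SetLike.mem_coe]
  constructor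
  · intro h v hv
    rw [hmem, ← Face.sign_eq hv, h]
  · intro h
    obtain ⟨v, hv⟩ := x.2.1
    rw [Face.sign_eq hv, ← hmem]
    exact h hv

/-- The support of a face, as an element of the intersection lattice. -/
def Face.flat (x : Face W) : Flat W := ⟨x.supp, x, rfl⟩

lemma Face.flat_surjective : Function.Surjective (Face.flat (W := W)) := by
  rintro ⟨_, x, rfl⟩
  exact ⟨x, rfl⟩

lemma Face.flat_smul (w : W) (x : Face W) : (w • x).flat = w • x.flat :=
  Subtype.ext (Face.supp_smul w x)

lemma Face.flat_le_flat {x y : Face W} :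
    x.flat ≤ y.flat ↔ ∀ H, y.sign H = 0 → x.sign H = 0 := by
  constructor
  · intro h H hH
    rw [Face.sign_eq_zero_iff] at hH ⊢
    intro v hv
    have h1 : v ∈ x.supp := by
      rw [Face.supp, Submodule.mem_sInf]
      exact fun K hK => hK.2 hv
    have h2 : y.supp ≤ H.1 := sInf_le ⟨H.2, hH⟩
    exact h2 (h h1)
  · intro h
    change x.supp ≤ y.supp
    refine sInf_le_sInf ?_
    rintro K ⟨hK, hy⟩
    exact ⟨hK, Face.sign_eq_zero_iff (H := ⟨K, hK⟩).1 (h _ (Face.sign_eq_zero_iff.2 hy))⟩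

lemma Face.flat_one_le (X : Flat W) : (1 : Face W).flat ≤ X := by
  obtain ⟨z, rfl⟩ := Face.flat_surjective X
  rw [Face.flat_le_flat]
  exact fun H _ => Face.sign_one H

lemma Flat.eq_of_le_of_orbit_eq [FiniteDimensional ℝ V] {X Y : Flat W} (h : X ≤ Y)
    (ho : X.orbit = Y.orbit) : X = Y := by
  obtain ⟨w, rfl⟩ := Flat.orbit_eq_iff.1 ho
  exact Subtype.ext (Submodule.eq_of_le_of_finrank_le h (Flat.finrank_smul w X).le)

variable [Finite W]

lemma Face.mul_eq_left_iff {x y : Face W} : y * x = y ↔ x.flat ≤ y.flat := by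
  rw [Face.flat_le_flat]
  constructor
  · intro h H hH
    have := Face.sign_mul y x H
    rw [h] at this
    simpa [hH] using this.symm
  · intro h
    refine Face.ext_sign (funext fun H => ?_)
    rw [Face.sign_mul]
    split_ifs with hH
    · rfl
    · rw [not_not] at hH
      rw [h H hH, hH]

lemma Face.flat_mul_le_iff {x y : Face W} {Z : Flat W} :
    (x * y).flat ≤ Z ↔ x.flat ≤ Z ∧ y.flat ≤ Z := by
  obtain ⟨z, rfl⟩ := Face.flat_surjective Z
  simp only [Face.flat_le_flat, Face.sign_mul]
  constructor
  · intro h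
    refine ⟨fun H hH => ?_, fun H hH => ?_⟩ <;>
    · have := h H hH
      split_ifs at this with h1
      · exact absurd this h1
      · simp_all
  · rintro ⟨h1, h2⟩ H hH
    rw [h1 H hH, h2 H hH]
    simp

lemma Face.le_flat_mul_left (x y : Face W) : x.flat ≤ (x * y).flat :=
  (Face.flat_mul_le_iff.1 le_rfl).1

lemma Face.le_flat_mul_right (x y : Face W) : y.flat ≤ (x * y).flat :=
  (Face.flat_mul_le_iff.1 le_rfl).2

instance : Fintype (Face W) := Fintype.ofFinite _

instance : Fintype (Flat W) := Fintype.ofFinite _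

instance : Fintype (FlatOrbit W) := Fintype.ofFinite _

end Flats

/-! ### The idempotents of the face algebra -/

section Idempotents

open MonoidAlgebra

variable {V : Type*} [AddCommGroup V] [Module ℝ V] {W : Subgroup (V ≃ₗ[ℝ] V)} [Finite W]
  {k : Type*} [Field k]

lemma eq_sum_single {M : Type*} [Fintype M] (a : MonoidAlgebra k M) :
    a = ∑ x, a.coeff x • single x 1 := by
  conv_lhs => rw [← sum_coeff_single a, Finsupp.sum_fintype _ _ (fun _ => single_zero _)]
  simp

@[simp] lemma act_single (w : W) (x : Face W) (r : k) :
    act W k w (single x r) = single (w • x) r := by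
  simp [act]

/-- The character of the face algebra that sends a face to `1` if its support is contained in `X`,
and to `0` otherwise. -/
def character (k : Type*) [Field k] (X : Flat W) : FaceAlgebra W k →ₐ[k] k := by
  classical
  exact MonoidAlgebra.lift k k (Face W)
    { toFun := fun x => if x.flat ≤ X then 1 else 0
      map_one' := if_pos (Face.flat_one_le X)
      map_mul' := fun x y => by
        by_cases hx : x.flat ≤ X <;> by_cases hy : y.flat ≤ X <;>
          simp [Face.flat_mul_le_iff, hx, hy] }

lemma character_single_of_le {X : Flat W} {x : Face W} (h : x.flat ≤ X) :
    character k X (single x 1) = 1 := by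
  simp [character, h]

lemma character_single_of_not_le {X : Flat W} {x : Face W} (h : ¬ x.flat ≤ X) :
    character k X (single x 1) = 0 := by
  simp [character, h]

lemma character_smul_act (w : W) (X : Flat W) (a : FaceAlgebra W k) :
    character k (w • X) (act W k w a) = character k X a := by
  have hle : ∀ x : Face W, (w • x).flat ≤ w • X ↔ x.flat ≤ X := fun x => by
    rw [Face.flat_smul]
    refine ⟨fun h => ?_, Flat.smul_le_smul w⟩
    simpa using Flat.smul_le_smul w⁻¹ h
  rw [eq_sum_single a]
  simp only [map_sum, map_smul, act_single]
  refine Finset.sum_congr rfl fun x _ => ?_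
  by_cases hx : x.flat ≤ X
  · rw [character_single_of_le hx, character_single_of_le ((hle x).2 hx)]
  · rw [character_single_of_not_le hx, character_single_of_not_le (mt (hle x).1 hx)]

variable {l : Flat W → FaceAlgebra W k}

lemma IsInvariantFamily.flat_eq (hl : IsInvariantFamily l) {X : Flat W} {x : Face W}
    (hx : (l X).coeff x ≠ 0) : x.flat = X :=
  Subtype.ext (hl.1 X x (Finsupp.mem_support_iff.2 hx))

lemma IsInvariantFamily.sum_coeff (hl : IsInvariantFamily l) (X : Flat W) :
    ∑ x, (l X).coeff x = 1 := by
  rw [← hl.2.1 X, Finsupp.sum_fintype _ _ (fun _ => rfl)]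

/-- A linear map that takes the same value at all faces of support `X` takes this value at `l X`. -/
lemma IsInvariantFamily.map_eq (hl : IsInvariantFamily l) {X : Flat W} {E : Type*}
    [AddCommGroup E] [Module k E] (f : FaceAlgebra W k →ₗ[k] E) {c : E}
    (hf : ∀ x : Face W, x.flat = X → f (single x 1) = c) : f (l X) = c := by
  rw [eq_sum_single (l X), map_sum]
  conv_rhs => rw [← one_smul k c, ← hl.sum_coeff X, Finset.sum_smul]
  refine Finset.sum_congr rfl fun x _ => ?_
  rw [map_smul]
  by_cases hx : (l X).coeff x = 0
  · rw [hx, zero_smul, zero_smul]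
  · rw [hf x (hl.flat_eq hx)]

lemma IsInvariantFamily.single_mul (hl : IsInvariantFamily l) (z : Face W) :
    single z 1 * l z.flat = single z 1 :=
  hl.map_eq (LinearMap.mulLeft k (single z 1)) fun x hx => by
    rw [LinearMap.mulLeft_apply, single_mul_single, Face.mul_eq_left_iff.2 hx.le, one_mul]

lemma IsInvariantFamily.mul_self (hl : IsInvariantFamily l) (X : Flat W) : l X * l X = l X := by
  have h : l X * l X - l X = 0 :=
    hl.map_eq (LinearMap.mulRight k (l X) - LinearMap.id) fun x hx => by
      rw [LinearMap.sub_apply, LinearMap.mulRight_apply, ← hx, hl.single_mul, LinearMap.id_apply,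
        sub_self]
  exact sub_eq_zero.1 h

open Classical in
lemma idem_eq_mul (l : Flat W → FaceAlgebra W k) (X : Flat W) :
    idem l X = l X * (1 - ∑ Y with X < Y, idem l Y) := by
  rw [idem_eq, mul_sub, mul_one, Finset.mul_sum]
  exact congrArg (l X - ·) (Finset.sum_subtype (p := fun Y => X < Y) {Y | X < Y}
    (fun Y => by rw [Finset.mem_filter]; simp) fun Y => l X * idem l Y).symm

open Classical in
lemma IsInvariantFamily.single_mul_idem_self (hl : IsInvariantFamily l) (z : Face W) :
    single z 1 * idem l z.flat = single z 1 - ∑ Y with z.flat < Y, single z 1 * idem l Y := by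
  rw [idem_eq_mul, ← mul_assoc, hl.single_mul, mul_sub, mul_one, Finset.mul_sum]

/-- A face whose support is not contained in `X` annihilates `e_X`. -/
lemma IsInvariantFamily.single_mul_idem (hl : IsInvariantFamily l) (X : Flat W) :
    ∀ y : Face W, ¬ y.flat ≤ X → single y 1 * idem l X = 0 := by
  classical
  induction X using WellFoundedGT.induction with
  | ind X ih =>
    intro y hy
    rw [idem_eq_mul]
    set R := (1 - ∑ Y with X < Y, idem l Y)
    refine hl.map_eq (LinearMap.mulLeft k (single y 1) ∘ₗ LinearMap.mulRight k R) fun x hx => ?_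
    rw [LinearMap.comp_apply, LinearMap.mulLeft_apply, LinearMap.mulRight_apply, ← mul_assoc,
      single_mul_single, one_mul]
    -- the face `z = y * x` has support `Z > X`, and `z = ∑_{Y ≥ Z} z * e_Y`
    set z := y * x with hz
    have hXz : X < z.flat := by
      refine lt_of_le_of_ne (hx ▸ Face.le_flat_mul_right y x) fun h => hy ?_
      rw [h]
      exact Face.le_flat_mul_left y x
    have hsplit : ∑ Y with X < Y, single z (1 : k) * idem l Y =
        single z 1 * idem l z.flat + ∑ Y with z.flat < Y, single z 1 * idem l Y := by
      rw [← Finset.sum_insert (f := fun Y => single z 1 * idem l Y) (by simp)]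
      symm
      refine Finset.sum_subset ?_ ?_
      · intro Y hY
        rw [Finset.mem_insert, Finset.mem_filter] at hY
        rw [Finset.mem_filter]
        rcases hY with rfl | ⟨-, h⟩
        · exact ⟨Finset.mem_univ _, hXz⟩
        · exact ⟨Finset.mem_univ _, hXz.trans h⟩
      · intro Y hY hY'
        rw [Finset.mem_insert, Finset.mem_filter, not_or] at hY'
        refine ih Y (Finset.mem_filter.1 hY).2 z fun hle => ?_
        rcases hle.eq_or_lt with h | h
        · exact hY'.1 h.symm
        · exact hY'.2 ⟨Finset.mem_univ _, h⟩
    rw [mul_sub, mul_one, Finset.mul_sum, hsplit, hl.single_mul_idem_self]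
    abel

lemma IsInvariantFamily.mul_mul_idem (hl : IsInvariantFamily l) {X Y : Flat W} (h : ¬ X ≤ Y)
    (b : FaceAlgebra W k) : l X * b * idem l Y = 0 := by
  rw [mul_assoc]
  refine hl.map_eq (LinearMap.mulRight k (b * idem l Y)) fun x hx => ?_
  rw [LinearMap.mulRight_apply, eq_sum_single b, Finset.sum_mul, Finset.mul_sum]
  refine Finset.sum_eq_zero fun y _ => ?_
  rw [smul_mul_assoc, mul_smul_comm, ← mul_assoc, single_mul_single, one_mul,
    hl.single_mul_idem Y _ fun hle => h ?_, smul_zero]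
  rw [← hx]
  exact (Face.le_flat_mul_left x y).trans hle

/-- `e_X` lies in the span of the faces with support at least `X`, on which multiplication by `x`
from the right is trivial. -/
lemma IsInvariantFamily.idem_mul_single (hl : IsInvariantFamily l) {X : Flat W} {x : Face W}
    (h : x.flat ≤ X) : idem l X * single x 1 = idem l X := by
  classical
  rw [idem_eq_mul]
  set b := (1 - ∑ Y with X < Y, idem l Y)
  have key : l X * b * single x 1 - l X * b = 0 :=
    hl.map_eq (LinearMap.mulRight k (single x 1) ∘ₗ LinearMap.mulRight k b -
      LinearMap.mulRight k b) fun y hy => by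
      rw [LinearMap.sub_apply, LinearMap.comp_apply, LinearMap.mulRight_apply,
        LinearMap.mulRight_apply, sub_eq_zero, eq_sum_single b, Finset.mul_sum, Finset.sum_mul]
      refine Finset.sum_congr rfl fun z _ => ?_
      rw [mul_smul_comm, smul_mul_assoc, single_mul_single, single_mul_single, one_mul, one_mul,
        Face.mul_eq_left_iff.2]
      exact h.trans (hy ▸ Face.le_flat_mul_left y z)
  exact sub_eq_zero.1 key

lemma IsInvariantFamily.idem_mul_mul_idem (hl : IsInvariantFamily l) {X Y : Flat W}
    (h : ¬ X ≤ Y) (a : FaceAlgebra W k) : idem l X * a * idem l Y = 0 := by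
  classical
  rw [idem_eq_mul l X, mul_assoc (l X)]
  exact hl.mul_mul_idem h _

lemma IsInvariantFamily.idem_mul_mul_self (hl : IsInvariantFamily l) (X : Flat W)
    (hX : idem l X * idem l X = idem l X) (a : FaceAlgebra W k) :
    idem l X * a * idem l X = character k X a • idem l X := by
  conv_lhs => rw [eq_sum_single a]
  conv_rhs => rw [eq_sum_single a]
  rw [Finset.mul_sum, Finset.sum_mul, map_sum, Finset.sum_smul]
  refine Finset.sum_congr rfl fun x _ => ?_
  rw [mul_smul_comm, smul_mul_assoc, map_smul, smul_assoc]
  congr 1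
  by_cases hx : x.flat ≤ X
  · rw [hl.idem_mul_single hx, character_single_of_le hx, hX, one_smul]
  · rw [mul_assoc, hl.single_mul_idem X x hx, character_single_of_not_le hx, mul_zero, zero_smul]

open Classical in
lemma IsInvariantFamily.idem_mul_idem (hl : IsInvariantFamily l) (X Y : Flat W) :
    idem l X * idem l Y = if X = Y then idem l X else 0 := by
  induction X using WellFoundedGT.induction with
  | ind X ih =>
    have h1 : idem l X * idem l Y = l X * (idem l Y - ∑ Z with X < Z, idem l Z * idem l Y) := by
      rw [idem_eq_mul l X, mul_assoc, sub_mul, one_mul, Finset.sum_mul]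
    have h2 : ∑ Z with X < Z, idem l Z * idem l Y = if X < Y then idem l Y else 0 := by
      rw [Finset.sum_congr rfl fun Z hZ => ih Z (Finset.mem_filter.1 hZ).2, Finset.sum_ite_eq']
      simp
    rw [h1, h2]
    by_cases hlt : X < Y
    · rw [if_pos hlt, if_neg hlt.ne, sub_self, mul_zero]
    · rw [if_neg hlt, sub_zero]
      split_ifs with he
      · subst he
        rw [idem_eq_mul l X, ← mul_assoc, hl.mul_self]
      · have := hl.mul_mul_idem (fun hle => hlt (lt_of_le_of_ne hle he)) 1
        rwa [mul_one] at this

lemma IsInvariantFamily.sum_idem (hl : IsInvariantFamily l) : ∑ X, idem l X = 1 := by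
  classical
  have h := hl.single_mul_idem_self (1 : Face W)
  have hf : (Finset.univ.filter fun Y => (1 : Face W).flat < Y) =
      Finset.univ.erase (1 : Face W).flat := by
    ext Y
    simp [lt_iff_le_and_ne, Face.flat_one_le, eq_comm]
  rw [← one_def, hf, one_mul, eq_sub_iff_add_eq] at h
  simp only [one_mul] at h
  rw [← h, Finset.add_sum_erase _ _ (Finset.mem_univ _)]

lemma IsInvariantFamily.act_idem (hl : IsInvariantFamily l) (w : W) (X : Flat W) :
    act W k w (idem l X) = idem l (w • X) := by
  classical
  induction X using WellFoundedGT.induction with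
  | ind X ih =>
    rw [idem_eq_mul, idem_eq_mul, map_mul, hl.2.2, map_sub, map_one, map_sum,
      Finset.sum_congr rfl fun Y hY => ih Y (Finset.mem_filter.1 hY).2]
    congr 2
    have hlt : ∀ (w : W) {X Y : Flat W}, X < Y → w • X < w • Y := fun w X Y h =>
      lt_of_le_of_ne (Flat.smul_le_smul w h.le) fun he => h.ne (MulAction.injective w he)
    refine Finset.sum_bij' (fun Y _ => w • Y) (fun Y _ => w⁻¹ • Y) ?_ ?_ (by simp) (by simp)
      (by simp)
    · intro Y hY
      rw [Finset.mem_filter] at hY ⊢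
      exact ⟨Finset.mem_univ _, hlt w hY.2⟩
    · intro Y hY
      rw [Finset.mem_filter] at hY ⊢
      refine ⟨Finset.mem_univ _, ?_⟩
      simpa using hlt w⁻¹ hY.2

lemma IsInvariantFamily.character_idem (hl : IsInvariantFamily l) (X : Flat W) :
    character k X (idem l X) = 1 := by
  classical
  have h1 : ∀ Y, X < Y → character k X (idem l Y) = 0 := fun Y hY => by
    rw [idem_eq_mul, map_mul]
    have : character k X (l Y) = 0 := hl.map_eq (character k X).toLinearMap fun x hx =>
      character_single_of_not_le (hx ▸ hY.not_ge)
    rw [this, zero_mul]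
  have h2 : character k X (l X) = 1 := hl.map_eq (character k X).toLinearMap fun x hx =>
      character_single_of_le hx.le
  rw [idem_eq_mul, map_mul, h2, map_sub, map_one, map_sum,
    Finset.sum_eq_zero fun Y hY => h1 Y (Finset.mem_filter.1 hY).2]
  simp

end Idempotents

/-! ### The invariant subalgebra -/

section Invariants

open MonoidAlgebra

variable {V : Type*} [AddCommGroup V] [Module ℝ V] {W : Subgroup (V ≃ₗ[ℝ] V)} [Finite W]
  {k : Type*} [Field k] {l : Flat W → FaceAlgebra W k}

open Classical in
lemma orbitIdem_eq (l : Flat W → FaceAlgebra W k) (P : FlatOrbit W) :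
    orbitIdem l P = ∑ X with X.orbit = P, idem l X := by
  rw [orbitIdem]
  convert (Finset.sum_subtype (p := fun X : Flat W => X.orbit = P) {X | X.orbit = P}
    (fun X => by simp) _).symm

lemma IsInvariantFamily.orbitIdem_mem (hl : IsInvariantFamily l) (P : FlatOrbit W) :
    orbitIdem l P ∈ invariantSubalgebra W k := by
  classical
  intro w
  rw [orbitIdem_eq, map_sum, Finset.sum_congr rfl fun X _ => hl.act_idem w X]
  have ho : ∀ (w : W) (X : Flat W), (w • X).orbit = X.orbit := fun w X =>
    (Flat.orbit_eq_iff.2 ⟨w, rfl⟩).symm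
  refine Finset.sum_bij' (fun Y _ => w • Y) (fun Y _ => w⁻¹ • Y) ?_ ?_ (by simp) (by simp)
    (by simp) <;> simp [ho]

/-- The element `ε_𝒪`, in the algebra of invariants. -/
def IsInvariantFamily.orbitIdem (hl : IsInvariantFamily l) (P : FlatOrbit W) :
    invariantSubalgebra W k := ⟨FaceAlg.orbitIdem l P, hl.orbitIdem_mem P⟩

lemma IsInvariantFamily.orbitIdem_ne_zero (hl : IsInvariantFamily l) (P : FlatOrbit W) :
    hl.orbitIdem P ≠ 0 := by
  classical
  intro h
  obtain ⟨X, rfl⟩ : ∃ X : Flat W, X.orbit = P := Quotient.exists_rep P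
  have h1 : idem l X * FaceAlg.orbitIdem l X.orbit = idem l X := by
    rw [orbitIdem_eq, Finset.mul_sum, Finset.sum_congr rfl fun Y _ => hl.idem_mul_idem X Y,
      Finset.sum_ite_eq]
    simp
  rw [show FaceAlg.orbitIdem l X.orbit = 0 from congrArg Subtype.val h, mul_zero] at h1
  have h2 := hl.character_idem X
  rw [← h1, map_zero] at h2
  exact zero_ne_one h2

theorem IsInvariantFamily.isTriangular [FiniteDimensional ℝ V] (hl : IsInvariantFamily l) :
    IsTriangular k hl.orbitIdem := by
  classical
  refine ⟨?_, fun P Q hPQ => Subtype.ext ?_, fun P Q a hPQ => Subtype.ext ?_, fun P a => ?_⟩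
  · apply Subtype.ext
    rw [AddSubmonoidClass.coe_finsetSum]
    change ∑ P, FaceAlg.orbitIdem l P = 1
    simp only [orbitIdem_eq]
    exact (Finset.sum_fiberwise Finset.univ Flat.orbit (idem l)).trans hl.sum_idem
  · change FaceAlg.orbitIdem l P * FaceAlg.orbitIdem l Q = 0
    rw [orbitIdem_eq, orbitIdem_eq, Finset.sum_mul_sum]
    refine Finset.sum_eq_zero fun X hX => Finset.sum_eq_zero fun Y hY => ?_
    rw [hl.idem_mul_idem, if_neg]
    rintro rfl
    exact hPQ ((Finset.mem_filter.1 hX).2.symm.trans (Finset.mem_filter.1 hY).2)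
  · change FaceAlg.orbitIdem l P * a.1 * FaceAlg.orbitIdem l Q = 0
    rw [orbitIdem_eq, orbitIdem_eq, Finset.sum_mul, Finset.sum_mul_sum]
    refine Finset.sum_eq_zero fun X hX => Finset.sum_eq_zero fun Y hY => ?_
    refine hl.idem_mul_mul_idem (fun hle => hPQ ?_) _
    exact ⟨X, Y, (Finset.mem_filter.1 hX).2, (Finset.mem_filter.1 hY).2, hle⟩
  · obtain ⟨X₀, rfl⟩ : ∃ X : Flat W, X.orbit = P := Quotient.exists_rep P
    refine ⟨character k X₀ a.1, Subtype.ext ?_⟩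
    change FaceAlg.orbitIdem l X₀.orbit * a.1 * FaceAlg.orbitIdem l X₀.orbit =
      character k X₀ a.1 • FaceAlg.orbitIdem l X₀.orbit
    rw [orbitIdem_eq, Finset.sum_mul, Finset.sum_mul_sum, Finset.smul_sum]
    refine Finset.sum_congr rfl fun X hX => ?_
    have hX' := (Finset.mem_filter.1 hX).2
    rw [Finset.sum_eq_single X]
    · rw [hl.idem_mul_mul_self X (by rw [hl.idem_mul_idem, if_pos rfl])]
      obtain ⟨w, rfl⟩ := Flat.orbit_eq_iff.1 hX'.symm
      rw [← character_smul_act w X₀, a.2 w]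
    · intro Y hY hne
      refine hl.idem_mul_mul_idem (fun hle => hne ?_) _
      exact (Flat.eq_of_le_of_orbit_eq hle (hX'.trans (Finset.mem_filter.1 hY).2.symm)).symm
    · exact fun h => absurd hX h

lemma natCast_ne_zero_of_dvd {n m : ℕ} (hm : ¬ ringChar k ∣ m) (h : n ∣ m) : (n : k) ≠ 0 :=
  fun h0 => hm (((ringChar.spec k n).1 h0).trans h)

open Classical in
lemma card_filter_smul_eq {G X : Type*} [Group G] [Fintype G] [MulAction G X] {x y : X} {g : G}
    (hg : g • x = y) :
    (Finset.univ.filter fun w : G => w • x = y).card = Nat.card (MulAction.stabilizer G x) := by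
  rw [← Fintype.card_coe, ← Nat.card_eq_fintype_card]
  refine Nat.card_congr ((Equiv.mulLeft g⁻¹).subtypeEquiv fun w => ?_)
  simp only [Finset.mem_filter, Finset.mem_univ, true_and, MulAction.mem_stabilizer_iff,
    Equiv.coe_mulLeft, mul_smul, inv_smul_eq_iff, hg]

/-- Averaging a face over the elements of `W` that move its support to `X` gives an invariant
family; the number of these elements is the order of a stabilizer, hence invertible in `k`. -/
theorem exists_isInvariantFamily (hk : ¬ ringChar k ∣ Nat.card W) :
    ∃ l : Flat W → FaceAlgebra W k, IsInvariantFamily l := by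
  classical
  let _ : Fintype W := Fintype.ofFinite W
  have hx : ∀ P : FlatOrbit W, ∃ x : Face W, x.flat.orbit = P := fun P => by
    obtain ⟨X, rfl⟩ : ∃ X : Flat W, X.orbit = P := Quotient.exists_rep P
    obtain ⟨x, rfl⟩ := Face.flat_surjective X
    exact ⟨x, rfl⟩
  choose x hx using hx
  let N : Flat W → Finset W := fun X => {w | (w • x X.orbit).flat = X}
  have ho : ∀ (w : W) (X : Flat W), (w • X).orbit = X.orbit := fun w X =>
    (Flat.orbit_eq_iff.2 ⟨w, rfl⟩).symm
  have hN : ∀ X, ((N X).card : k) ≠ 0 := fun X => by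
    obtain ⟨g, hg⟩ := Flat.orbit_eq_iff.1 (hx X.orbit)
    refine natCast_ne_zero_of_dvd hk ?_
    have : (N X).card = Nat.card (MulAction.stabilizer W (x X.orbit).flat) := by
      simp only [N, Face.flat_smul]
      convert card_filter_smul_eq hg
    rw [this]
    exact Subgroup.card_subgroup_dvd_card _
  have hNs : ∀ (w u : W) (X : Flat W), w * u ∈ N (w • X) ↔ u ∈ N X := fun w u X => by
    simp only [N, Finset.mem_filter, Finset.mem_univ, true_and, ho, mul_smul, Face.flat_smul]
    exact (MulAction.injective w).eq_iff
  refine ⟨fun X => ((N X).card : k)⁻¹ • ∑ w ∈ N X, single (w • x X.orbit) 1, fun X y hy => ?_,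
    fun X => ?_, fun w X => ?_⟩
  · rw [Finsupp.mem_support_iff, coeff_smul_apply, coeff_sum] at hy
    have : ∑ w ∈ N X, (single (w • x X.orbit) (1 : k)).coeff y ≠ 0 := fun h => hy (by
      rw [Finsupp.finsetSum_apply, h, smul_zero])
    obtain ⟨w, hw, hne⟩ := Finset.exists_ne_zero_of_sum_ne_zero this
    rw [coeff_single, Finsupp.single_apply] at hne
    have h1 : w • x X.orbit = y := by
      by_contra hcon
      rw [if_neg hcon] at hne
      exact hne rfl
    rw [← h1]
    exact congrArg Subtype.val (Finset.mem_filter.1 hw).2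
  · rw [Finsupp.sum_fintype _ _ (fun _ => rfl)]
    simp only [coeff_smul, coeff_sum, Finsupp.smul_apply, Finsupp.finsetSum_apply]
    rw [← Finset.smul_sum, Finset.sum_comm]
    simp [hN X]
  · simp only [map_smul, map_sum, act_single, ho]
    have hcard : (N (w • X)).card = (N X).card := by
      symm
      refine Finset.card_bij (fun u _ => w * u) (fun u hu => (hNs w u X).2 hu)
        (fun _ _ _ _ h => mul_left_cancel h) fun u hu => ⟨w⁻¹ * u, ?_, by simp⟩
      rw [← hNs w]
      simpa using hu
    rw [hcard]
    congr 1
    refine Finset.sum_bij' (fun u _ => w * u) (fun u _ => w⁻¹ * u) (fun u hu => (hNs w u X).2 hu)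
      (fun u hu => ?_) (by simp) (by simp) (by simp [mul_smul])
    rw [← hNs w]
    simpa using hu

end Invariants

/-! ### Reflections -/

section Reflections

variable {V : Type*} [AddCommGroup V] [Module ℝ V]

/-- A reflection whose hyperplane is the kernel of `f` is `v ↦ v - f v • a` with `f a = 2`. -/
lemma IsReflection.exists_root {s : V ≃ₗ[ℝ] V} (hs : IsReflection s) {f : Module.Dual ℝ V}
    (hf : LinearMap.ker f = fixedSpace s) : ∃ a, f a = 2 ∧ ∀ v, s v = v - f v • a := by
  have hfix : ∀ v, f v = 0 ↔ s v = v := fun v => by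
    rw [← LinearMap.mem_ker, hf, mem_fixedSpace]
  obtain ⟨u, hu⟩ : ∃ u, f u = 1 := by
    have h1 : ¬ ∀ u, f u = 0 := fun h => hs.2.1 (by
      rw [← hf]
      ext v
      simp [h v])
    push Not at h1
    obtain ⟨u, hu⟩ := h1
    exact ⟨(f u)⁻¹ • u, by simp [hu]⟩
  have hform : ∀ v, s v = v - f v • (u - s u) := fun v => by
    have h0 : f (v - f v • u) = 0 := by simp [hu]
    have h1 := (hfix _).1 h0
    rw [map_sub, map_smul, sub_eq_iff_eq_add] at h1
    rw [h1, smul_sub]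
    abel
  refine ⟨u - s u, ?_, hform⟩
  have hss : ∀ v, s (s v) = v := fun v => DFunLike.congr_fun hs.1 v
  have hne : u - s u ≠ 0 := fun h => by
    have := (hfix u).2 (sub_eq_zero.1 h).symm
    rw [hu] at this
    exact one_ne_zero this
  have h1 := hform (u - s u)
  rw [map_sub, hss] at h1
  have h2 : (2 - f (u - s u)) • (u - s u) = 0 := by
    rw [sub_smul, two_smul, sub_eq_zero, ← sub_sub_cancel (u - s u) (f (u - s u) • (u - s u)), ← h1]
    abel
  exact (sub_eq_zero.1 ((smul_eq_zero.1 h2).resolve_right hne)).symm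

variable {W : Subgroup (V ≃ₗ[ℝ] V)}

/-- In a finite group a reflection is determined by its hyperplane: the product of two reflections
in the same hyperplane is a transvection, and has finite order only if it is trivial. -/
lemma IsReflection.eq_of_fixedSpace_eq [Finite W] {s t : W} (hs : IsReflection s.1)
    (ht : IsReflection t.1) (h : fixedSpace s.1 = fixedSpace t.1) : s = t := by
  obtain ⟨f, hf⟩ := exists_form W ⟨fixedSpace s.1, s.1, s.2, hs, rfl⟩
  change LinearMap.ker f = fixedSpace s.1 at hf
  obtain ⟨a, ha, hsa⟩ := hs.exists_root hf
  obtain ⟨b, hb, htb⟩ := ht.exists_root (hf.trans h)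
  have hst : ∀ v, (s * t).1 v = v + f v • (a - b) := fun v => by
    change s.1 (t.1 v) = _
    rw [hsa, htb, map_sub, map_smul, hb, smul_eq_mul, smul_sub, mul_two, sub_add_cancel_left,
      neg_smul]
    abel
  have hpow : ∀ (n : ℕ) v, ((s * t) ^ n).1 v = v + n • f v • (a - b) := by
    intro n
    induction n with
    | zero => intro v; simp
    | succ n ih =>
      intro v
      rw [pow_succ]
      change ((s * t) ^ n).1 ((s * t).1 v) = _
      rw [hst, ih, map_add, map_smul, map_sub, ha, hb, sub_self, smul_zero, add_zero, succ_nsmul]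
      abel
  obtain ⟨n, hn, h1⟩ := (isOfFinOrder_of_finite (s * t)).exists_pow_eq_one
  have h2 := hpow n a
  rw [h1] at h2
  have h3 : n • f a • (a - b) = 0 := left_eq_add.1 h2
  have h4 : a = b := by
    rw [ha, ← Nat.cast_smul_eq_nsmul ℝ, smul_eq_zero, smul_eq_zero, sub_eq_zero,
      Nat.cast_eq_zero] at h3
    rcases h3 with h3 | h3 | h3
    · omega
    · norm_num at h3
    · exact h3
  apply Subtype.ext
  ext v
  rw [hsa, htb, h4]

/-- The reflection in `W` with hyperplane `H`. -/
def refl (H : arrangement W) : W := ⟨H.2.choose, H.2.choose_spec.1⟩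

lemma isReflection_refl (H : arrangement W) : IsReflection (refl H).1 := H.2.choose_spec.2.1

lemma fixedSpace_refl (H : arrangement W) : fixedSpace (refl H).1 = H.1 := H.2.choose_spec.2.2

lemma refl_mul_self (H : arrangement W) : refl H * refl H = 1 :=
  Subtype.ext (isReflection_refl H).1

lemma refl_inv (H : arrangement W) : (refl H)⁻¹ = refl H :=
  inv_eq_of_mul_eq_one_left (refl_mul_self H)

lemma refl_mul_cancel (H : arrangement W) (w : W) : refl H * (refl H * w) = w := by
  rw [← mul_assoc, refl_mul_self, one_mul]

lemma refl_smul_smul {X : Type*} [MulAction W X] (H : arrangement W) (x : X) :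
    refl H • refl H • x = x := by
  rw [smul_smul, refl_mul_self, one_smul]

lemma refl_apply_eq_iff {H : arrangement W} {v : V} : (refl H).1 v = v ↔ form W H v = 0 := by
  rw [← mem_fixedSpace, fixedSpace_refl, ← ker_form, LinearMap.mem_ker]

lemma refl_ne_one (H : arrangement W) : refl H ≠ 1 := fun h => by
  refine (isReflection_refl H).2.1 (eq_top_iff.2 fun v _ => ?_)
  rw [mem_fixedSpace, h]
  rfl

lemma form_refl (H : arrangement W) (v : V) : form W H ((refl H).1 v) = -form W H v := by
  obtain ⟨a, ha, hs⟩ := (isReflection_refl H).exists_root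
    ((ker_form W H).trans (fixedSpace_refl H).symm)
  rw [hs, map_sub, map_smul, ha, smul_eq_mul]
  ring

lemma eq_refl_of_isReflection [Finite W] {s : W} (hs : IsReflection s.1) {H : arrangement W}
    (h : fixedSpace s.1 = H.1) : s = refl H :=
  hs.eq_of_fixedSpace_eq (isReflection_refl H) (h.trans (fixedSpace_refl H).symm)

lemma refl_mapHyp [Finite W] (w : W) (H : arrangement W) :
    refl (mapHyp w H) = w * refl H * w⁻¹ := by
  symm
  refine eq_refl_of_isReflection ⟨?_, ?_⟩ ?_
  · have : (w * refl H * w⁻¹) * (w * refl H * w⁻¹) = 1 := by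
      simp only [mul_assoc, inv_mul_cancel_left, refl_mul_cancel, mul_inv_cancel]
    exact congrArg Subtype.val this
  · change IsCoatom (fixedSpace (w.1 * (refl H).1 * w.1⁻¹))
    rw [fixedSpace_conj]
    exact (OrderIso.isCoatom_iff (Submodule.orderIsoMapComap w.1) _).2 (isReflection_refl H).2
  · change fixedSpace (w.1 * (refl H).1 * w.1⁻¹) = _
    rw [fixedSpace_conj, fixedSpace_refl]
    rfl

lemma mapHyp_inv' (w : W) (H : arrangement W) : mapHyp w⁻¹ (mapHyp w H) = H := by
  simpa using mapHyp_inv w⁻¹ H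

lemma mapHyp_injective (w : W) : Function.Injective (mapHyp w) :=
  Function.LeftInverse.injective (mapHyp_inv' w)

lemma Face.refl_smul_sign (H : arrangement W) (x : Face W) :
    (refl H • x).sign H = -x.sign H := by
  obtain ⟨v, hv⟩ := x.2.1
  have h1 : (refl H).1 v ∈ (refl H • x).1 := ⟨v, hv, rfl⟩
  rw [Face.sign_eq h1, Face.sign_eq hv, form_refl, Left.sign_neg]

lemma Face.refl_smul_of_sign_eq_zero {H : arrangement W} {x : Face W} (h : x.sign H = 0) :
    refl H • x = x := by
  apply Subtype.ext
  have : ∀ v ∈ x.1, (refl H).1 v = v := fun v hv => by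
    rw [refl_apply_eq_iff, ← _root_.sign_eq_zero_iff, ← Face.sign_eq hv, h]
  rw [Face.coe_smul, Set.image_congr this, Set.image_id']

lemma Face.smul_sign_eq_iff (w : W) (x y : Face W) (H : arrangement W) :
    (w • x).sign (mapHyp w H) = (w • y).sign (mapHyp w H) ↔ x.sign H = y.sign H := by
  obtain ⟨τ, hτ, h⟩ := Face.sign_smul w H
  rw [h, h]
  exact mul_right_inj' hτ

end Reflections

/-! ### Chambers and their walls -/

section Chambers

variable {V : Type*} [AddCommGroup V] [Module ℝ V] {W : Subgroup (V ≃ₗ[ℝ] V)}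

/-- A face of maximal dimension: it lies on no hyperplane of the arrangement. -/
def Face.IsTop (C : Face W) : Prop := ∀ H, C.sign H ≠ 0

/-- The closed cone of a face, described by weak inequalities. -/
def Face.closedCone (C : Face W) : Set V :=
  {v | ∀ H, SignType.sign (form W H v) = 0 ∨ SignType.sign (form W H v) = C.sign H}

/-- `H` is a wall of `C` if its intersection with the closed cone of `C` spans `H`. -/
def Face.HasWall (C : Face W) (H : arrangement W) : Prop :=
  Submodule.span ℝ ((H.1 : Set V) ∩ C.closedCone) = H.1

/-- The hyperplanes that separate two faces. -/
def Face.sep (x y : Face W) : Set (arrangement W) := {H | x.sign H ≠ y.sign H}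

lemma Face.mem_sep {x y : Face W} {H : arrangement W} : H ∈ x.sep y ↔ x.sign H ≠ y.sign H :=
  Iff.rfl

lemma Face.sep_smul_smul (w : W) (x y : Face W) : (w • x).sep (w • y) = mapHyp w '' x.sep y := by
  ext H
  constructor
  · intro h
    refine ⟨mapHyp w⁻¹ H, ?_, mapHyp_inv w H⟩
    rw [Face.mem_sep] at h ⊢
    rwa [Ne, ← Face.smul_sign_eq_iff w, mapHyp_inv]
  · rintro ⟨K, hK, rfl⟩
    rw [Face.mem_sep] at hK ⊢
    rwa [Ne, Face.smul_sign_eq_iff]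

lemma Face.ncard_sep_smul_smul (w : W) (x y : Face W) :
    ((w • x).sep (w • y)).ncard = (x.sep y).ncard := by
  rw [Face.sep_smul_smul, Set.ncard_image_of_injective _ (mapHyp_injective w)]

lemma Face.ncard_sep_refl_smul (H : arrangement W) (x y : Face W) :
    (x.sep (refl H • y)).ncard = ((refl H • x).sep y).ncard := by
  rw [← Face.ncard_sep_smul_smul (refl H), refl_smul_smul]

lemma Face.ncard_sep_smul (w : W) (x y : Face W) :
    (x.sep (w • y)).ncard = ((w⁻¹ • x).sep y).ncard := by
  rw [← Face.ncard_sep_smul_smul w⁻¹, inv_smul_smul]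

lemma Face.IsTop.smul {C : Face W} (hC : C.IsTop) (w : W) : (w • C).IsTop := by
  intro H
  obtain ⟨τ, hτ, h⟩ := Face.sign_smul w (mapHyp w⁻¹ H)
  rw [← mapHyp_inv w H, h]
  exact mul_ne_zero hτ (hC _)

lemma Face.IsTop.neg_eq {C D : Face W} (hC : C.IsTop) (hD : D.IsTop) {H : arrangement W}
    (h : C.sign H ≠ D.sign H) : -C.sign H = D.sign H := by
  have h1 := hC H
  have h2 := hD H
  revert h h1 h2
  generalize C.sign H = a
  generalize D.sign H = b
  revert a b
  decide

lemma sign_add_smul_of_same {p q : V} {H : arrangement W} {σ : SignType} {ε : ℝ} (hε : 0 < ε)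
    (hp : SignType.sign (form W H p) = 0 ∨ SignType.sign (form W H p) = σ)
    (hq : SignType.sign (form W H q) = σ) : SignType.sign (form W H (p + ε • q)) = σ := by
  rw [map_add, map_smul, smul_eq_mul]
  have h1 : SignType.sign (ε * form W H q) = σ := by
    rw [_root_.sign_mul, sign_pos hε, one_mul, hq]
  rcases hp with hp | hp
  · rw [sign_eq_zero_iff.1 hp, zero_add, h1]
  · rcases lt_trichotomy (form W H p) 0 with h | h | h
    · rw [sign_neg h] at hp
      subst hp
      rw [sign_eq_neg_one_iff] at h1 ⊢
      linarith
    · rw [h, zero_add, h1]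
    · rw [sign_pos h] at hp
      subst hp
      rw [sign_eq_one_iff] at h1 ⊢
      linarith

/-- A vector that enters the face `C` when moved towards a point of `C` lies in the closed cone. -/
lemma Face.mem_closedCone_of_forall {C : Face W} (hC : C.IsTop) {p v : V} (hp : p ∈ C.1)
    (h : ∀ ε : ℝ, 0 < ε → v + ε • p ∈ C.1) : v ∈ C.closedCone := by
  intro H
  by_contra! hcon
  obtain ⟨h0, h1⟩ := hcon
  have hpC := Face.sign_eq hp H
  have hp0 : form W H p ≠ 0 := fun h => hC H (by rw [hpC, h, sign_zero])
  -- otherwise the forms at `v` and `p` have opposite signs and cancel for a suitable `ε`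
  have hε : 0 < -form W H v / form W H p := by
    rw [hpC] at h1
    rcases lt_trichotomy (form W H v) 0 with hv | hv | hv <;>
      rcases lt_or_gt_of_ne hp0 with hq | hq
    · exact absurd (by rw [sign_neg hv, sign_neg hq]) h1
    · exact div_pos (by linarith) hq
    · exact absurd (by rw [hv, sign_zero]) h0
    · exact absurd (by rw [hv, sign_zero]) h0
    · exact div_pos_of_neg_of_neg (by linarith) hq
    · exact absurd (by rw [sign_pos hv, sign_pos hq]) h1
  have h2 := Face.sign_eq (h _ hε) H
  rw [map_add, map_smul, smul_eq_mul, div_mul_cancel₀ _ hp0, add_neg_cancel, sign_zero] at h2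
  exact hC H h2

/-- The only hyperplane that separates a chamber from its mirror image in a wall is this wall. -/
lemma Face.sep_refl_smul {C : Face W} (hC : C.IsTop) {H : arrangement W} (hH : C.HasWall H) :
    C.sep (refl H • C) = {H} := by
  ext K
  rw [Face.mem_sep, Set.mem_singleton_iff]
  constructor
  · intro hK
    by_contra hne
    -- a point of the wall in the closed cone but outside `K` is fixed by the reflection
    obtain ⟨z, ⟨hzH, hzC⟩, hzK⟩ : ∃ z ∈ (H.1 : Set V) ∩ C.closedCone, form W K z ≠ 0 := by
      by_contra! hcon
      have hle : H.1 ≤ K.1 := by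
        rw [← hH, Submodule.span_le]
        intro z hz
        rw [SetLike.mem_coe, ← ker_form, LinearMap.mem_ker]
        exact hcon z hz
      have hco : ∀ L : arrangement W, IsCoatom L.1 := fun L => by
        rw [← fixedSpace_refl L]
        exact (isReflection_refl L).2
      rcases (hco H).le_iff.1 hle with h | h
      · exact (hco K).1 h
      · exact hne (Subtype.ext h)
    have h0 : SignType.sign (form W K z) ≠ 0 := sign_ne_zero.2 hzK
    have hfix : (refl H).1 z = z := by
      rw [refl_apply_eq_iff, ← LinearMap.mem_ker, ker_form]
      exact hzH
    obtain ⟨L, rfl⟩ : ∃ L, mapHyp (refl H) L = K := ⟨_, mapHyp_inv (refl H) K⟩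
    obtain ⟨c, hc, hcv⟩ := form_mapHyp (refl H) L
    obtain ⟨p, hp⟩ := C.2.1
    have hp' : (refl H).1 p ∈ (refl H • C).1 := ⟨p, hp, rfl⟩
    have hz := hcv z
    rw [hfix] at hz
    have h1 := (hzC (mapHyp (refl H) L)).resolve_left h0
    have hL0 : SignType.sign (form W L z) ≠ 0 := fun h => h0 (by
      rw [hz, _root_.sign_mul, h, mul_zero])
    have h2 := (hzC L).resolve_left hL0
    refine hK ?_
    rw [Face.sign_eq hp', hcv, _root_.sign_mul, ← Face.sign_eq hp, ← h2, ← _root_.sign_mul, ← hz,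
      h1]
  · rintro rfl
    rw [Face.refl_smul_sign]
    have := hC K
    revert this
    generalize C.sign K = a
    revert a
    decide

variable [Finite W]

/-- The strict inequalities satisfied at `p` persist after a small move in the direction `q`. -/
lemma exists_small_smul (p q : V) : ∃ ε : ℝ, 0 < ε ∧ ∀ H : arrangement W,
    SignType.sign (form W H p) ≠ 0 →
      SignType.sign (form W H (p + ε • q)) = SignType.sign (form W H p) := by
  have key : ∀ᶠ ε : ℝ in nhdsWithin 0 (Set.Ioi 0), ∀ H : arrangement W,
      SignType.sign (form W H p) ≠ 0 →
        SignType.sign (form W H (p + ε • q)) = SignType.sign (form W H p) := by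
    rw [Filter.eventually_all]
    intro H
    simp only [map_add, map_smul, smul_eq_mul]
    have hc : Filter.Tendsto (fun ε : ℝ => form W H p + ε * form W H q)
        (nhdsWithin 0 (Set.Ioi 0)) (nhds (form W H p)) := by
      have : Continuous (fun ε : ℝ => form W H p + ε * form W H q) := by fun_prop
      have h := this.tendsto 0
      simp only [zero_mul, add_zero] at h
      exact h.mono_left nhdsWithin_le_nhds
    rcases lt_trichotomy (form W H p) 0 with h | h | h
    · filter_upwards [hc.eventually_lt_const h] with ε hε
      simp [sign_neg h, sign_neg hε]
    · simp [h]
    · filter_upwards [hc.eventually_const_lt h] with ε hε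
      simp [sign_pos h, sign_pos hε]
  obtain ⟨ε, hε, hpos⟩ := (key.and self_mem_nhdsWithin).exists
  exact ⟨ε, hpos, hε⟩

/-- A member of a minimal set of hyperplanes whose strict inequalities cut out `C` is a wall. -/
lemma Face.hasWall_of_minimal {C : Face W} (hC : C.IsTop) {M : Set (arrangement W)}
    (hM : ∀ v, (∀ H ∈ M, SignType.sign (form W H v) = C.sign H) → v ∈ C.1)
    {H : arrangement W} {v : V}
    (hv : ∀ K ∈ M, K ≠ H → SignType.sign (form W K v) = C.sign K) (hvC : v ∉ C.1) :
    C.HasWall H := by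
  obtain ⟨p, hp⟩ := C.2.1
  have hpC := fun K => (Face.sign_eq hp K).symm
  have hvH : SignType.sign (form W H v) ≠ C.sign H := fun h => hvC (hM v fun K hK => by
    by_cases hKH : K = H
    · rw [hKH, h]
    · exact hv K hK hKH)
  set a := form W H p with ha
  set b := form W H v with hb
  have ha0 : a ≠ 0 := fun h => hC H (by rw [← hpC, ← ha, h, sign_zero])
  have hab : 0 ≤ -(a * b) := by
    rw [← hpC, ← ha] at hvH
    by_contra! hcon
    have hpos : 0 < a * b := by linarith
    rcases pos_and_pos_or_neg_and_neg_of_mul_pos hpos with ⟨h1, h2⟩ | ⟨h1, h2⟩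
    · exact hvH (by rw [sign_pos h1, sign_pos h2])
    · exact hvH (by rw [sign_neg h1, sign_neg h2])
  -- the point of `H` on the segment from `p` to `v`, up to a positive factor
  set z := -(a * b) • p + (a * a) • v with hz
  have hzH : form W H z = 0 := by
    rw [hz, map_add, map_smul, map_smul, ← ha, ← hb, smul_eq_mul, smul_eq_mul]
    ring
  have hzK : ∀ K ∈ M, K ≠ H → SignType.sign (form W K z) = C.sign K := fun K hK hKH => by
    refine sign_add_smul_of_same (mul_self_pos.2 ha0) ?_ (hv K hK hKH)
    rw [map_smul, smul_eq_mul, _root_.sign_mul, hpC]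
    rcases hab.eq_or_lt with h | h
    · left
      rw [← h, sign_zero, zero_mul]
    · right
      rw [sign_pos h, one_mul]
  have hcone : ∀ y, form W H y = 0 → (∀ K ∈ M, K ≠ H → SignType.sign (form W K y) = C.sign K) →
      y ∈ Submodule.span ℝ ((H.1 : Set V) ∩ C.closedCone) := fun y hy hyK => by
    refine Submodule.subset_span ⟨?_, Face.mem_closedCone_of_forall hC hp fun ε hε => ?_⟩
    · rwa [SetLike.mem_coe, ← ker_form, LinearMap.mem_ker]
    · refine hM _ fun K hK => sign_add_smul_of_same hε ?_ (hpC K)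
      by_cases hKH : K = H
      · left
        rw [hKH, hy, sign_zero]
      · exact Or.inr (hyK K hK hKH)
  refine le_antisymm (Submodule.span_le.2 Set.inter_subset_left) fun h hh => ?_
  rw [← ker_form, LinearMap.mem_ker] at hh
  obtain ⟨ε, hε, hsmall⟩ := exists_small_smul (W := W) z h
  have h1 := hcone z hzH hzK
  have h2 := hcone (z + ε • h) (by rw [map_add, map_smul, hzH, hh, smul_zero, add_zero])
    fun K hK hKH => by
      rw [hsmall K (by rw [hzK K hK hKH]; exact hC K), hzK K hK hKH]
  have h3 := Submodule.smul_mem _ ε⁻¹ (Submodule.sub_mem _ h2 h1)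
  rwa [add_sub_cancel_left, smul_smul, inv_mul_cancel₀ hε.ne', one_smul] at h3

/-- A chamber is cut out by the strict inequalities of its walls. -/
lemma Face.mem_of_walls {C : Face W} (hC : C.IsTop) {v : V}
    (h : ∀ H, C.HasWall H → SignType.sign (form W H v) = C.sign H) : v ∈ C.1 := by
  have hex : ∃ M : Set (arrangement W),
      Minimal (fun M => ∀ v, (∀ H ∈ M, SignType.sign (form W H v) = C.sign H) → v ∈ C.1) M :=
    (Set.toFinite {M : Set (arrangement W) |
      ∀ v, (∀ H ∈ M, SignType.sign (form W H v) = C.sign H) → v ∈ C.1}).exists_minimal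
      ⟨Set.univ, fun v hv => C.mem_iff.2 fun H => hv H (Set.mem_univ H)⟩
  obtain ⟨M, hM⟩ := hex
  refine hM.prop v fun H hH => h H ?_
  have hnot := hM.not_prop_of_lt (show M \ {H} < M from Set.sdiff_singleton_ssubset.2 hH)
  push Not at hnot
  obtain ⟨u, hu, huC⟩ := hnot
  exact Face.hasWall_of_minimal hC hM.prop (fun K hK hKH => hu K ⟨hK, hKH⟩) huC

lemma Face.mem_closedCone_of_walls {C : Face W} (hC : C.IsTop) {v : V}
    (h : ∀ H, C.HasWall H →
      SignType.sign (form W H v) = 0 ∨ SignType.sign (form W H v) = C.sign H) :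
    v ∈ C.closedCone := by
  obtain ⟨p, hp⟩ := C.2.1
  exact Face.mem_closedCone_of_forall hC hp fun ε hε => Face.mem_of_walls hC fun H hH =>
    sign_add_smul_of_same hε (h H hH) (Face.sign_eq hp H).symm

lemma Face.exists_wall_of_ne {C D : Face W} (hC : C.IsTop) (h : C ≠ D) :
    ∃ H, C.HasWall H ∧ H ∈ C.sep D := by
  by_contra! hcon
  refine h (Face.ext_sign (funext fun K => ?_))
  obtain ⟨v, hv⟩ := D.2.1
  have : v ∈ C.1 := Face.mem_of_walls hC fun H hH => by
    rw [← Face.sign_eq hv]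
    exact (not_not.1 (hcon H hH)).symm
  rw [Face.sign_eq this, Face.sign_eq hv]

end Chambers

/-! ### The exchange property and the length function -/

section Exchange

variable {V : Type*} [AddCommGroup V] [Module ℝ V] {W : Subgroup (V ≃ₗ[ℝ] V)}

/-- The reflections in the walls of a chamber. -/
def Face.simple (C : Face W) : Set W := {s | ∃ H, C.HasWall H ∧ refl H = s}

lemma Face.notMem_sep {x y : Face W} {H : arrangement W} : H ∉ x.sep y ↔ x.sign H = y.sign H :=
  not_not

lemma Face.sep_self (x : Face W) : x.sep x = ∅ := by
  ext H
  simp [Face.sep]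

variable {C : Face W}

lemma list_prod_mem_closure {J : Set W} {l : List W} (hl : ∀ s ∈ l, s ∈ J) :
    l.prod ∈ Subgroup.closure J :=
  Subgroup.list_prod_mem _ fun s hs => Subgroup.subset_closure (hl s hs)

lemma sign_sum_eq {ι : Type*} {s : Finset ι} (hs : s.Nonempty) {f : ι → ℝ} {σ : SignType}
    (h : ∀ i ∈ s, SignType.sign (f i) = σ) : SignType.sign (∑ i ∈ s, f i) = σ := by
  rcases σ.trichotomy with rfl | rfl | rfl
  · rw [sign_eq_neg_one_iff]
    exact Finset.sum_neg (fun i hi => sign_eq_neg_one_iff.1 (h i hi)) hs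
  · rw [sign_eq_zero_iff]
    exact Finset.sum_eq_zero fun i hi => sign_eq_zero_iff.1 (h i hi)
  · rw [sign_eq_one_iff]
    exact Finset.sum_pos (fun i hi => sign_eq_one_iff.1 (h i hi)) hs

/-- The simple reflections that fix the face `x`. -/
def Face.fixing (C x : Face W) : Set W := {s | ∃ H, C.HasWall H ∧ x.sign H = 0 ∧ refl H = s}

lemma Face.fixing_subset (C x : Face W) : C.fixing x ⊆ C.simple := by
  rintro _ ⟨H, hH, -, rfl⟩
  exact ⟨H, hH, rfl⟩

lemma Face.smul_eq_of_mem_closure_fixing {x : Face W} {u : W}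
    (hu : u ∈ Subgroup.closure (C.fixing x)) : u • x = x := by
  have : Subgroup.closure (C.fixing x) ≤ MulAction.stabilizer W x := by
    rw [Subgroup.closure_le]
    rintro _ ⟨H, -, h0, rfl⟩
    exact Face.refl_smul_of_sign_eq_zero h0
  exact this hu

variable [Finite W]

lemma Face.eq_of_ncard_sep {x y : Face W} (h : (x.sep y).ncard = 0) : x = y := by
  rw [Set.ncard_eq_zero (Set.toFinite _)] at h
  refine Face.ext_sign (funext fun H => ?_)
  rw [← Face.notMem_sep, h]
  exact Set.notMem_empty H

/-- Exchange property: if `H` separates `C` from its image under a product of simple reflections,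
then multiplication by the reflection in `H` amounts to deleting a factor. -/
lemma Face.exchange (hC : C.IsTop) (l : List W) (hl : ∀ s ∈ l, s ∈ C.simple) (H : arrangement W)
    (hH : H ∈ C.sep (l.prod • C)) :
    ∃ l' : List W, (∀ s ∈ l', s ∈ l) ∧ l'.length + 1 = l.length ∧ refl H * l.prod = l'.prod := by
  induction l generalizing H with
  | nil =>
    rw [List.prod_nil, one_smul, Face.sep_self] at hH
    exact absurd hH (Set.notMem_empty H)
  | cons s l ih =>
    obtain ⟨K, hK, rfl⟩ := hl s List.mem_cons_self
    rw [List.prod_cons] at hH ⊢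
    by_cases hHK : H = K
    · subst hHK
      exact ⟨l, fun t ht => List.mem_cons_of_mem _ ht, rfl, refl_mul_cancel H _⟩
    have h1 : C.sign H = (refl K • C).sign H := by
      rw [← Face.notMem_sep, Face.sep_refl_smul hC hK]
      exact hHK
    have h2 : mapHyp (refl K) H ∈ C.sep (l.prod • C) := by
      rw [Face.mem_sep, mul_smul, h1, Ne, ← Face.smul_sign_eq_iff (refl K), refl_smul_smul,
        refl_smul_smul] at hH
      exact hH
    obtain ⟨l', hl', hlen, hprod⟩ := ih (fun t ht => hl t (List.mem_cons_of_mem _ ht)) _ h2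
    refine ⟨refl K :: l', ?_, by simp [hlen], ?_⟩
    · intro t ht
      rcases List.mem_cons.1 ht with rfl | ht
      · exact List.mem_cons_self
      · exact List.mem_cons_of_mem _ (hl' t ht)
    · rw [List.prod_cons, ← hprod, refl_mapHyp, refl_inv]
      simp only [mul_assoc, refl_mul_cancel]

lemma Face.ncard_sep_refl_smul_of_wall (hC : C.IsTop) {D : Face W} (hD : D.IsTop)
    {H : arrangement W} (hH : C.HasWall H) (hs : H ∈ C.sep D) :
    (C.sep (refl H • D)).ncard + 1 = (C.sep D).ncard := by
  rw [Face.ncard_sep_refl_smul, ← Set.ncard_sdiff_singleton_add_one hs (Set.toFinite _)]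
  congr 2
  ext K
  rw [Set.mem_sdiff, Set.mem_singleton_iff]
  by_cases hKH : K = H
  · subst hKH
    rw [Face.mem_sep, Face.refl_smul_sign, hC.neg_eq hD hs]
    simp
  · have : C.sign K = (refl H • C).sign K := by
      rw [← Face.notMem_sep, Face.sep_refl_smul hC hH]
      exact hKH
    rw [Face.mem_sep, Face.mem_sep, ← this]
    simp [hKH]

/-- Every chamber is reached from `C` by a product of as many simple reflections as there are
separating hyperplanes. -/
lemma Face.exists_list (hC : C.IsTop) (D : Face W) (hD : D.IsTop) :
    ∃ l : List W, (∀ s ∈ l, s ∈ C.simple) ∧ l.prod • C = D ∧ l.length = (C.sep D).ncard := by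
  obtain ⟨n, hn⟩ : ∃ n, (C.sep D).ncard = n := ⟨_, rfl⟩
  induction n generalizing D with
  | zero =>
    refine ⟨[], by simp, ?_, hn.symm⟩
    rw [List.prod_nil, one_smul, Face.eq_of_ncard_sep hn]
  | succ n ih =>
    have hne : C ≠ D := by
      rintro rfl
      rw [Face.sep_self, Set.ncard_empty] at hn
      omega
    obtain ⟨H, hH, hs⟩ := Face.exists_wall_of_ne hC hne
    have h1 := Face.ncard_sep_refl_smul_of_wall hC hD hH hs
    obtain ⟨l, hl, hprod, hlen⟩ := ih (refl H • D) (hD.smul _) (by omega)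
    refine ⟨refl H :: l, ?_, ?_, by rw [List.length_cons, hlen, h1]⟩
    · intro t ht
      rcases List.mem_cons.1 ht with rfl | ht
      · exact ⟨H, hH, rfl⟩
      · exact hl t ht
    · rw [List.prod_cons, mul_smul, hprod, refl_smul_smul]

/-- A shortest nonempty word that stabilizes `C` could be shortened by the exchange property. -/
lemma Face.list_prod_eq_one (hC : C.IsTop) (l : List W) (hl : ∀ s ∈ l, s ∈ C.simple)
    (h : l.prod • C = C) : l.prod = 1 := by
  obtain ⟨n, hn⟩ : ∃ n, l.length = n := ⟨_, rfl⟩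
  induction n using Nat.strong_induction_on generalizing l with
  | _ n ih =>
    cases l with
    | nil => rfl
    | cons s l =>
      obtain ⟨K, hK, rfl⟩ := hl s List.mem_cons_self
      rw [List.prod_cons] at h ⊢
      have h1 : l.prod • C = refl K • C := by
        rw [mul_smul] at h
        rw [← refl_smul_smul K (l.prod • C), h]
      have h2 : K ∈ C.sep (l.prod • C) := by
        rw [h1, Face.sep_refl_smul hC hK]
        rfl
      obtain ⟨l', hl', hlen, hprod⟩ :=
        Face.exchange hC l (fun t ht => hl t (List.mem_cons_of_mem _ ht)) K h2
      rw [hprod] at h ⊢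
      rw [List.length_cons] at hn
      exact ih l'.length (by omega) l'
        (fun t ht => hl t (List.mem_cons_of_mem _ (hl' t ht))) h rfl

lemma exists_list_of_mem_closure {J : Set W} {w : W} (hw : w ∈ Subgroup.closure J) :
    ∃ l : List W, (∀ s ∈ l, s ∈ J) ∧ l.prod = w := by
  rw [← Subgroup.mem_toSubmonoid, Subgroup.closure_toSubmonoid_of_finite] at hw
  exact Submonoid.exists_list_of_mem_closure hw

/-- Every reflection is a product of simple ones: `H` separates `C` from its mirror image in `H`,
so the exchange property applies to a word that carries `C` to this image. -/
lemma Face.refl_mem_closure (hC : C.IsTop) (H : arrangement W) :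
    refl H ∈ Subgroup.closure C.simple := by
  obtain ⟨l, hl, hprod, -⟩ := Face.exists_list hC (refl H • C) (hC.smul _)
  have hH : H ∈ C.sep (l.prod • C) := by
    rw [hprod, Face.mem_sep, Face.refl_smul_sign]
    have := hC H
    revert this
    generalize C.sign H = a
    revert a
    decide
  obtain ⟨l', hl', -, h⟩ := Face.exchange hC l hl H hH
  rw [eq_mul_inv_of_mul_eq h]
  exact Subgroup.mul_mem _ (list_prod_mem_closure fun s hs => hl s (hl' s hs))
    (Subgroup.inv_mem _ (list_prod_mem_closure hl))

lemma Face.closure_simple (hW : Subgroup.closure {s | s ∈ W ∧ IsReflection s} = W)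
    (hC : C.IsTop) : Subgroup.closure C.simple = ⊤ := by
  rw [eq_top_iff]
  rintro ⟨w, hw⟩ -
  have key : ∀ u ∈ Subgroup.closure {s | s ∈ W ∧ IsReflection s},
      ∃ v ∈ Subgroup.closure C.simple, v.1 = u := by
    intro u hu
    induction hu using Subgroup.closure_induction with
    | mem s hs =>
      refine ⟨refl ⟨fixedSpace s, s, hs.1, hs.2, rfl⟩, Face.refl_mem_closure hC _, ?_⟩
      exact (congrArg Subtype.val (eq_refl_of_isReflection (s := ⟨s, hs.1⟩) hs.2 rfl)).symm
    | one => exact ⟨1, one_mem _, rfl⟩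
    | mul x y _ _ hx hy =>
      obtain ⟨x', hx', rfl⟩ := hx
      obtain ⟨y', hy', rfl⟩ := hy
      exact ⟨x' * y', mul_mem hx' hy', rfl⟩
    | inv x _ hx =>
      obtain ⟨x', hx', rfl⟩ := hx
      exact ⟨x'⁻¹, inv_mem hx', rfl⟩
  obtain ⟨v, hv, h⟩ := key w (hW.symm ▸ hw)
  rwa [show v = ⟨w, hw⟩ from Subtype.ext h] at hv

/-- The group acts freely on chambers. -/
lemma Face.eq_one_of_smul_eq (hW : Subgroup.closure {s | s ∈ W ∧ IsReflection s} = W)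
    (hC : C.IsTop) {w : W} (h : w • C = C) : w = 1 := by
  have hw : w ∈ Subgroup.closure C.simple := by
    rw [Face.closure_simple hW hC]
    trivial
  obtain ⟨l, hl, rfl⟩ := exists_list_of_mem_closure hw
  exact Face.list_prod_eq_one hC l hl h

lemma Face.smul_left_injective (hW : Subgroup.closure {s | s ∈ W ∧ IsReflection s} = W)
    (hC : C.IsTop) : Function.Injective fun w : W => w • C := by
  intro w u h
  have h1 : (w⁻¹ * u) • C = C := by
    rw [mul_smul, inv_smul_eq_iff]
    exact h.symm
  exact (inv_mul_eq_one.1 (Face.eq_one_of_smul_eq hW hC h1))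

lemma Face.exists_smul_eq (hC : C.IsTop) {D : Face W} (hD : D.IsTop) : ∃ w : W, w • C = D := by
  obtain ⟨l, -, h, -⟩ := Face.exists_list hC D hD
  exact ⟨_, h⟩

lemma Face.ncard_sep_list_prod (hC : C.IsTop) (l : List W) (hl : ∀ s ∈ l, s ∈ C.simple) :
    (C.sep (l.prod • C)).ncard ≤ l.length := by
  induction l with
  | nil => simp [Face.sep_self]
  | cons s l ih =>
    obtain ⟨K, hK, rfl⟩ := hl s List.mem_cons_self
    have hsub : C.sep ((refl K :: l).prod • C) ⊆
        insert K ((refl K • C).sep (refl K • l.prod • C)) := by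
      intro H hH
      rw [Set.mem_insert_iff, or_iff_not_imp_left]
      intro hHK
      have : C.sign H = (refl K • C).sign H := by
        rw [← Face.notMem_sep, Face.sep_refl_smul hC hK]
        exact hHK
      rwa [Face.mem_sep, ← this, ← mul_smul, ← List.prod_cons]
    calc _ ≤ _ := Set.ncard_le_ncard hsub (Set.toFinite _)
      _ ≤ _ := Set.ncard_insert_le _ _
      _ ≤ _ := by
        rw [Face.ncard_sep_smul_smul, List.length_cons]
        exact Nat.succ_le_succ (ih fun t ht => hl t (List.mem_cons_of_mem _ ht))

/-- The length of `w` is the number of hyperplanes that separate `C` from `w C`. -/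
theorem Face.length_eq (hW : Subgroup.closure {s | s ∈ W ∧ IsReflection s} = W)
    (hC : C.IsTop) (w : W) : length C.simple w = (C.sep (w • C)).ncard := by
  obtain ⟨l, hl, hprod, hlen⟩ := Face.exists_list hC (w • C) (hC.smul w)
  refine le_antisymm (Nat.sInf_le ⟨l, hl, Face.smul_left_injective hW hC hprod, hlen⟩) ?_
  refine le_csInf ⟨_, l, hl, Face.smul_left_injective hW hC hprod, hlen⟩ ?_
  rintro _ ⟨l', hl', rfl, rfl⟩
  exact Face.ncard_sep_list_prod hC l' hl'

/-! ### The faces of a chamber and minimal coset representatives -/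

lemma Face.mul_eq_right_iff {x y : Face W} :
    x * y = y ↔ ∀ H, x.sign H ≠ 0 → x.sign H = y.sign H := by
  constructor
  · intro h H hH
    rw [← h, Face.sign_mul, if_pos hH]
  · intro h
    refine Face.ext_sign (funext fun H => ?_)
    rw [Face.sign_mul]
    split_ifs with hH
    · exact h H hH
    · rfl

lemma Face.IsTop.mul (hC : C.IsTop) (x : Face W) : (x * C).IsTop := by
  intro H
  rw [Face.sign_mul]
  split_ifs with h
  · exact h
  · exact hC H

/-- Two faces of a chamber in the same orbit coincide: `u x` lies in the closures of `C` and `u C`,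
hence on any wall that separates them, and reflecting in this wall brings `u C` closer to `C`. -/
lemma Face.smul_eq_of_mul_eq (hW : Subgroup.closure {s | s ∈ W ∧ IsReflection s} = W)
    (hC : C.IsTop) {x : Face W} (hx : x * C = C) (u : W) (hu : (u • x) * C = C) : u • x = x := by
  obtain ⟨n, hn⟩ : ∃ n, (C.sep (u • C)).ncard = n := ⟨_, rfl⟩
  induction n generalizing u with
  | zero =>
    rw [Face.eq_one_of_smul_eq hW hC (Face.eq_of_ncard_sep hn).symm, one_smul]
  | succ n ih =>
    have hne : C ≠ u • C := fun h => by
      rw [← h, Face.sep_self, Set.ncard_empty] at hn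
      omega
    obtain ⟨H, hH, hs⟩ := Face.exists_wall_of_ne hC hne
    have hu' : (u • x) * (u • C) = u • C := by rw [← smul_mul', hx]
    have h0 : (u • x).sign H = 0 := by
      by_contra h0
      exact hs ((Face.mul_eq_right_iff.1 hu H h0).symm.trans (Face.mul_eq_right_iff.1 hu' H h0))
    have h1 : (refl H * u) • x = u • x := by
      rw [mul_smul, Face.refl_smul_of_sign_eq_zero h0]
    have h2 := Face.ncard_sep_refl_smul_of_wall hC (hC.smul u) hH hs
    rw [← h1]
    refine ih (refl H * u) (by rw [h1, hu]) ?_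
    rw [mul_smul]
    omega

/-- For a face `x` of the chamber `C`, an element `w` has minimal length in its coset modulo the
parabolic subgroup of `x` exactly if `w C` is the projection of `C` on the face `w x`. -/
theorem Face.mem_minimalReps_iff (hW : Subgroup.closure {s | s ∈ W ∧ IsReflection s} = W)
    (hC : C.IsTop) {x : Face W} (hx : x * C = C) (w : W) :
    w ∈ minimalReps C.simple (C.fixing x) ↔ (w • x) * C = w • C := by
  have htr : (w • x) * C = w • C ↔ x * (w⁻¹ • C) = C := by
    rw [← (MulAction.injective w⁻¹).eq_iff, smul_mul', inv_smul_smul, inv_smul_smul]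
  have hlen : ∀ u : W, length C.simple (w * u) = ((w⁻¹ • C).sep (u • C)).ncard := fun u => by
    rw [Face.length_eq hW hC, mul_smul, Face.ncard_sep_smul]
  have hlen1 := hlen 1
  rw [mul_one, one_smul] at hlen1
  rw [htr]
  constructor
  · intro hw
    by_contra hne
    obtain ⟨H, hH, hs⟩ := Face.exists_wall_of_ne hC (Ne.symm hne)
    have h0 : x.sign H = 0 := by
      by_contra h0
      refine hs ?_
      rw [Face.sign_mul, if_pos h0, Face.mul_eq_right_iff.1 hx H h0]
    have h1 : H ∈ C.sep (w⁻¹ • C) := by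
      rw [Face.mem_sep, Face.sign_mul, h0] at hs
      rw [Face.mem_sep]
      simpa using hs
    have h2 := hw (refl H) (Subgroup.subset_closure ⟨H, hH, h0, rfl⟩)
    have h3 := Face.ncard_sep_refl_smul_of_wall hC (hC.smul w⁻¹) hH h1
    have hcomm : ∀ y z : Face W, y.sep z = z.sep y := fun y z => by
      ext K
      exact ne_comm
    rw [hlen, hlen1, Face.ncard_sep_refl_smul, hcomm _ C, hcomm _ C] at h2
    omega
  · intro h u hu
    rw [hlen, hlen1]
    refine Set.ncard_le_ncard (fun H hH => ?_) (Set.toFinite _)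
    have hx0 : x.sign H ≠ 0 := fun h0 => hH (by
      conv_rhs => rw [← h]
      rw [Face.sign_mul, h0]
      simp)
    have hxu : x * (u • C) = u • C := by
      conv_lhs => rw [← Face.smul_eq_of_mem_closure_fixing hu, ← smul_mul', hx]
    rw [Face.mem_sep, ← Face.mul_eq_right_iff.1 hxu H hx0, Face.mul_eq_right_iff.1 hx H hx0]
    exact hH

/-- A simple reflection in a standard parabolic subgroup is one of its generators: the wall of the
first letter of a shortest word for it separates `C` from its mirror image. -/
lemma Face.mem_of_mem_closure (hC : C.IsTop) {J : Set W} (hJ : J ⊆ C.simple) {H : arrangement W}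
    (hH : C.HasWall H) (h : refl H ∈ Subgroup.closure J) : refl H ∈ J := by
  obtain ⟨l, hl, hprod⟩ := exists_list_of_mem_closure h
  obtain ⟨n, hn⟩ : ∃ n, l.length = n := ⟨_, rfl⟩
  induction n using Nat.strong_induction_on generalizing l with
  | _ n ih =>
    cases l with
    | nil => exact absurd hprod.symm (refl_ne_one H)
    | cons s l =>
      obtain ⟨K, hK, rfl⟩ := hJ (hl s List.mem_cons_self)
      have hl' : ∀ t ∈ l, t ∈ J := fun t ht => hl t (List.mem_cons_of_mem _ ht)
      rw [List.prod_cons] at hprod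
      by_cases hKH : K = H
      · rw [← hKH]
        exact hl _ List.mem_cons_self
      have h1 : C.sign K = (refl H • C).sign K := by
        rw [← Face.notMem_sep, Face.sep_refl_smul hC hH]
        exact hKH
      have h2 : K ∈ C.sep (l.prod • C) := by
        rw [← hprod, mul_smul, Face.refl_smul_sign] at h1
        rw [Face.mem_sep, h1]
        have := hC.smul l.prod K
        revert this
        generalize (l.prod • C).sign K = a
        revert a
        decide
      obtain ⟨l'', hl'', hlen, hp⟩ := Face.exchange hC l (fun t ht => hJ (hl' t ht)) K h2
      rw [List.length_cons] at hn
      exact ih l''.length (by omega) l'' (fun t ht => hl' t (hl'' t ht)) (hp ▸ hprod) rfl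

/-- Every set `J` of simple reflections is the set of simple reflections that fix some face of the
chamber: sum the images of a point of the chamber under the subgroup generated by `J`. -/
lemma Face.exists_fixing_eq (hC : C.IsTop) {J : Set W} (hJ : J ⊆ C.simple) :
    ∃ x : Face W, x * C = C ∧ C.fixing x = J := by
  classical
  let _ : Fintype W := Fintype.ofFinite W
  obtain ⟨p, hp⟩ := C.2.1
  let G : Finset W := {u | u ∈ Subgroup.closure J}
  have hG : ∀ {u}, u ∈ G ↔ u ∈ Subgroup.closure J := by simp [G]
  set v : V := ∑ u ∈ G, u.1 p with hv
  have h0 : ∀ H, refl H ∈ J → SignType.sign (form W H v) = 0 := fun H hH => by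
    rw [_root_.sign_eq_zero_iff, ← refl_apply_eq_iff, hv, map_sum]
    refine Finset.sum_bij' (fun u _ => refl H * u) (fun u _ => refl H * u) ?_ ?_
      (fun u _ => refl_mul_cancel H u) (fun u _ => refl_mul_cancel H u) (fun u _ => rfl) <;>
    exact fun u hu => hG.2 (mul_mem (Subgroup.subset_closure hH) (hG.1 hu))
  -- no `u` in the subgroup moves `C` across such a wall, by the exchange property
  have h1 : ∀ H, C.HasWall H → refl H ∉ J → SignType.sign (form W H v) = C.sign H := by
    intro H hH hHJ
    rw [hv, map_sum]
    refine sign_sum_eq ⟨1, hG.2 (one_mem _)⟩ fun u hu => ?_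
    have hpu : u.1 p ∈ (u • C).1 := ⟨p, hp, rfl⟩
    rw [← Face.sign_eq hpu]
    by_contra hne
    obtain ⟨l, hl, rfl⟩ := exists_list_of_mem_closure (hG.1 hu)
    obtain ⟨l', hl', -, h⟩ := Face.exchange hC l (fun s hs => hJ (hl s hs)) H (Ne.symm hne)
    refine hHJ (Face.mem_of_mem_closure hC hJ hH ?_)
    rw [eq_mul_inv_of_mul_eq h]
    exact mul_mem (list_prod_mem_closure fun s hs => hl s (hl' s hs))
      (inv_mem (list_prod_mem_closure hl))
  have hcone : v ∈ C.closedCone := Face.mem_closedCone_of_walls hC fun H hH => by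
    by_cases hHJ : refl H ∈ J
    · exact Or.inl (h0 H hHJ)
    · exact Or.inr (h1 H hH hHJ)
  have hx : ∀ H, (Face.mk (fun H => SignType.sign (form W H v)) ⟨v, fun _ => rfl⟩).sign H =
      SignType.sign (form W H v) := fun H => congrFun (Face.sign_mk _ _) H
  refine ⟨Face.mk (fun H => SignType.sign (form W H v)) ⟨v, fun _ => rfl⟩, ?_, ?_⟩
  · rw [Face.mul_eq_right_iff]
    intro H hH
    rw [hx] at hH ⊢
    exact (hcone H).resolve_left hH
  · ext s
    constructor
    · rintro ⟨H, hH, hH0, rfl⟩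
      by_contra hHJ
      rw [hx, h1 H hH hHJ] at hH0
      exact hC H hH0
    · intro hs
      obtain ⟨H, hH, rfl⟩ := hJ hs
      exact ⟨H, hH, (hx H).trans (h0 H hs), rfl⟩

end Exchange

/-! ### Chambers as connected components -/

section Topology

variable {V : Type*} [AddCommGroup V] [Module ℝ V] {W : Subgroup (V ≃ₗ[ℝ] V)}

lemma mem_compl_iUnion_arrangement {v : V} :
    v ∈ (⋃ H ∈ arrangement W, (H : Set V))ᶜ ↔ ∀ H : arrangement W, form W H v ≠ 0 := by
  simp only [Set.mem_compl_iff, Set.mem_iUnion, not_exists]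
  constructor
  · intro h H h0
    refine h H.1 H.2 ?_
    rwa [SetLike.mem_coe, ← ker_form, LinearMap.mem_ker]
  · intro h H hH hv
    refine h ⟨H, hH⟩ ?_
    rw [← LinearMap.mem_ker, ker_form]
    exact hv

lemma Face.add_smul_mem {C : Face W} {p v : V} (hp : p ∈ C.1)
    (hv : v ∈ C.closedCone) {ε : ℝ} (hε : 0 < ε) : v + ε • p ∈ C.1 :=
  C.mem_iff.2 fun H => sign_add_smul_of_same hε (hv H) (Face.sign_eq hp H).symm

variable [FiniteDimensional ℝ V] [TopologicalSpace V] [IsTopologicalAddGroup V]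
  [ContinuousSMul ℝ V] [T2Space V]

lemma continuous_form (H : arrangement W) : Continuous (form W H) :=
  LinearMap.continuous_of_finiteDimensional _

lemma Face.closure_eq {C : Face W} (hC : C.IsTop) : closure C.1 = C.closedCone := by
  apply subset_antisymm
  · refine closure_minimal (fun v hv H => Or.inr (Face.sign_eq hv H).symm) ?_
    have hset : C.closedCone = ⋂ H, {v | 0 ≤ ((C.sign H : SignType) : ℝ) * form W H v} := by
      ext v
      simp only [Face.closedCone, Set.mem_ofPred_eq, Set.mem_iInter]
      refine forall_congr' fun H => ?_
      have := hC H
      rcases (C.sign H).trichotomy with h | h | h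
      · rw [h]
        rcases lt_trichotomy (form W H v) 0 with hv | hv | hv <;>
          simp [hv, sign_neg, sign_pos, hv.le]
      · exact absurd h this
      · rw [h]
        rcases lt_trichotomy (form W H v) 0 with hv | hv | hv <;>
          simp [hv, sign_neg, sign_pos, hv.le]
    rw [hset]
    exact isClosed_iInter fun H =>
      isClosed_le continuous_const (continuous_const.mul (continuous_form H))
  · intro v hv
    obtain ⟨p, hp⟩ := C.2.1
    have hc : Filter.Tendsto (fun ε : ℝ => v + ε • p) (nhdsWithin 0 (Set.Ioi 0)) (nhds v) := by
      have : Continuous (fun ε : ℝ => v + ε • p) := by fun_prop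
      have h := this.tendsto 0
      simp only [zero_smul, add_zero] at h
      exact h.mono_left nhdsWithin_le_nhds
    refine mem_closure_of_tendsto hc ?_
    filter_upwards [self_mem_nhdsWithin] with ε hε
    exact Face.add_smul_mem hp hv hε

/-- A chamber is a face that lies on no hyperplane. -/
lemma IsChamber.exists_face {c : Set V} (hc : IsChamber W c) : ∃ C : Face W, C.IsTop ∧ C.1 = c := by
  obtain ⟨v, hv, rfl⟩ := hc
  have hv' := mem_compl_iUnion_arrangement.1 hv
  set C : Face W := Face.mk (fun H => SignType.sign (form W H v)) ⟨v, fun _ => rfl⟩ with hCdef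
  have hsign : ∀ H, C.sign H = SignType.sign (form W H v) := fun H =>
    congrFun (Face.sign_mk _ _) H
  have hC : C.IsTop := fun H => by
    rw [hsign]
    exact sign_ne_zero.2 (hv' H)
  have hvC : v ∈ C.1 := C.mem_iff.2 fun H => (hsign H).symm
  have hsub : C.1 ⊆ (⋃ H ∈ arrangement W, (H : Set V))ᶜ := fun u hu =>
    mem_compl_iUnion_arrangement.2 fun H h0 => hC H (by rw [Face.sign_eq hu, h0, sign_zero])
  refine ⟨C, hC, subset_antisymm ?_ ?_⟩
  · have hconv : Convex ℝ C.1 := by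
      intro x hx y hy a b ha hb hab
      rw [C.mem_iff] at hx hy ⊢
      intro H
      rcases hb.eq_or_lt with rfl | hb
      · rw [show a = 1 by linarith]
        simpa using hx H
      · refine sign_add_smul_of_same hb ?_ (hy H)
        rw [map_smul, smul_eq_mul, _root_.sign_mul, hx H]
        rcases ha.eq_or_lt with rfl | ha
        · simp
        · simp [sign_pos ha]
    exact hconv.isPreconnected.subset_connectedComponentIn hvC hsub
  · intro u hu
    rw [C.mem_iff]
    intro H
    have hpre := (isPreconnected_connectedComponentIn (x := v)
      (F := (⋃ H ∈ arrangement W, (H : Set V))ᶜ)).image (form W H) (continuous_form H).continuousOn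
    have hne : ∀ y ∈ form W H '' connectedComponentIn (⋃ H ∈ arrangement W, (H : Set V))ᶜ v,
        y ≠ 0 := by
      rintro _ ⟨y, hy, rfl⟩
      exact mem_compl_iUnion_arrangement.1 (connectedComponentIn_subset _ _ hy) H
    have h1 : form W H v ∈ form W H '' connectedComponentIn (⋃ H ∈ arrangement W, (H : Set V))ᶜ v :=
      ⟨v, mem_connectedComponentIn hv, rfl⟩
    have h2 : form W H u ∈ form W H '' connectedComponentIn (⋃ H ∈ arrangement W, (H : Set V))ᶜ v :=
      ⟨u, hu, rfl⟩
    rw [hsign]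
    have ho := hpre.ordConnected
    rcases lt_or_gt_of_ne (hne _ h1) with hv0 | hv0 <;>
      rcases lt_or_gt_of_ne (hne _ h2) with hu0 | hu0
    · rw [sign_neg hv0, sign_neg hu0]
    · exact absurd rfl (hne 0 (ho.out h1 h2 ⟨hv0.le, hu0.le⟩))
    · exact absurd rfl (hne 0 (ho.out h2 h1 ⟨hu0.le, hv0.le⟩))
    · rw [sign_pos hv0, sign_pos hu0]

lemma Face.simpleReflections_eq [Finite W] {C : Face W} (hC : C.IsTop) :
    simpleReflections W C.1 = C.simple := by
  ext s
  constructor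
  · rintro ⟨hs, hmem, hspan⟩
    rw [Face.closure_eq hC] at hspan
    exact ⟨⟨_, hmem⟩, hspan, (eq_refl_of_isReflection hs rfl).symm⟩
  · rintro ⟨H, hH, rfl⟩
    refine ⟨isReflection_refl H, ?_⟩
    rw [fixedSpace_refl]
    exact ⟨H.2, by rw [Face.closure_eq hC]; exact hH⟩

end Topology

/-! ### The descent algebra as an image of the invariants of the face algebra -/

section Bidigare

open MonoidAlgebra

variable {V : Type*} [AddCommGroup V] [Module ℝ V] {W : Subgroup (V ≃ₗ[ℝ] V)} [Finite W]
  {k : Type*} [Field k] {C : Face W}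

lemma Face.mul_self (x : Face W) : x * x = x := Face.mul_eq_left_iff.2 le_rfl

/-- The element of `W` that moves the chamber `C` to its projection `x * C` on the face `x`. -/
def Face.IsTop.proj (hC : C.IsTop) (x : Face W) : W := (Face.exists_smul_eq hC (hC.mul x)).choose

lemma Face.IsTop.proj_smul (hC : C.IsTop) (x : Face W) : hC.proj x • C = x * C :=
  (Face.exists_smul_eq hC (hC.mul x)).choose_spec

lemma Face.IsTop.proj_eq_iff (hW : Subgroup.closure {s | s ∈ W ∧ IsReflection s} = W) (hC : C.IsTop)
    {x : Face W} {w : W} : hC.proj x = w ↔ x * C = w • C := by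
  rw [← Face.IsTop.proj_smul hC]
  exact (Face.smul_left_injective hW hC).eq_iff.symm

/-- The linear map `kℱ → kW` that reads off the action of the face algebra on the chamber `C`: it
sends `x` to the `w` with `x * C = w C`. -/
def projMap (k : Type*) [Field k] (hC : C.IsTop) : FaceAlgebra W k →ₗ[k] MonoidAlgebra k W :=
  mapDomainLinearMap k k (hC.proj)

lemma projMap_single (hC : C.IsTop) (x : Face W) :
    projMap k hC (single x 1) = single (hC.proj x) 1 :=
  mapDomainLinearMap_single ..

lemma projMap_one (hW : Subgroup.closure {s | s ∈ W ∧ IsReflection s} = W) (hC : C.IsTop) :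
    projMap k hC 1 = 1 := by
  rw [one_def, projMap_single, one_def, (Face.IsTop.proj_eq_iff hW hC).2]
  rw [one_mul, one_smul]

/-- On invariants the map `projMap` reverses products: with `y * C = v C`, invariance of `a` gives
`a * y * C = a * v C = v (a * C)`. -/
lemma projMap_mul (hW : Subgroup.closure {s | s ∈ W ∧ IsReflection s} = W) (hC : C.IsTop)
    {a : FaceAlgebra W k} (ha : a ∈ invariantSubalgebra W k) (b : FaceAlgebra W k) :
    projMap k hC (a * b) = projMap k hC b * projMap k hC a := by
  have h1 : ∀ x y : Face W, projMap k hC (single x 1 * single y 1) =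
      projMap k hC (single y 1) * projMap k hC (act W k (hC.proj y)⁻¹ (single x 1)) := by
    intro x y
    rw [single_mul_single, act_single, one_mul, projMap_single, projMap_single, projMap_single,
      single_mul_single, one_mul, (Face.IsTop.proj_eq_iff hW hC).2]
    rw [mul_smul, Face.IsTop.proj_smul, smul_mul', smul_inv_smul, Face.IsTop.proj_smul, mul_assoc]
  have h2 : ∀ y : Face W, projMap k hC (a * single y 1) =
      projMap k hC (single y 1) * projMap k hC a := by
    intro y
    have h3 : projMap k hC (a * single y 1) =
        projMap k hC (single y 1) * projMap k hC (act W k (hC.proj y)⁻¹ a) := by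
      rw [eq_sum_single a, Finset.sum_mul, map_sum, map_sum, map_sum, Finset.mul_sum]
      refine Finset.sum_congr rfl fun x _ => ?_
      rw [smul_mul_assoc, map_smul, map_smul, map_smul, mul_smul_comm, h1]
    rw [h3, ha]
  rw [eq_sum_single b, Finset.mul_sum, map_sum, map_sum, Finset.sum_mul]
  refine Finset.sum_congr rfl fun y _ => ?_
  rw [mul_smul_comm, map_smul, map_smul, smul_mul_assoc, h2]

/-- The image of the invariants of the face algebra in the group algebra. -/
def invariantImage (k : Type*) [Field k]
    (hW : Subgroup.closure {s | s ∈ W ∧ IsReflection s} = W) (hC : C.IsTop) :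
    Subalgebra k (MonoidAlgebra k W) where
  carrier := {y | ∃ a ∈ invariantSubalgebra W k, projMap k hC a = y}
  mul_mem' := by
    rintro _ _ ⟨a, ha, rfl⟩ ⟨b, hb, rfl⟩
    exact ⟨b * a, mul_mem hb ha, projMap_mul hW hC hb a⟩
  add_mem' := by
    rintro _ _ ⟨a, ha, rfl⟩ ⟨b, hb, rfl⟩
    exact ⟨a + b, add_mem ha hb, map_add _ a b⟩
  algebraMap_mem' c := ⟨algebraMap k _ c, algebraMap_mem _ c, by
    rw [Algebra.algebraMap_eq_smul_one, map_smul, projMap_one hW,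
      ← Algebra.algebraMap_eq_smul_one]⟩

/-- The algebra of invariants is triangular, hence so is its anti-homomorphic image. -/
lemma isQuasiHereditary_invariantImage [FiniteDimensional ℝ V]
    (hW : Subgroup.closure {s | s ∈ W ∧ IsReflection s} = W) (hC : C.IsTop)
    (hk : ¬ ringChar k ∣ Nat.card W) : IsQuasiHereditary (invariantImage k hW hC) := by
  obtain ⟨l, hl⟩ := exists_isInvariantFamily hk
  let f : invariantSubalgebra W k →ₗ[k] invariantImage k hW hC :=
    ((projMap k hC).comp (invariantSubalgebra W k).val.toLinearMap).codRestrict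
      (Subalgebra.toSubmodule (invariantImage k hW hC)) fun a => ⟨a.1, a.2, rfl⟩
  refine (hl.isTriangular.map_anti f (Subtype.ext (projMap_one hW hC))
    (fun a b => Subtype.ext (projMap_mul hW hC a.2 b.1)) ?_).isQuasiHereditary
  rintro ⟨_, a, ha, rfl⟩
  exact ⟨⟨a, ha⟩, rfl⟩

instance : Fintype W := Fintype.ofFinite W

/-- The sum of the images of a face under all elements of `W`. -/
def orbitSum (k : Type*) [Field k] (x : Face W) : FaceAlgebra W k := ∑ w : W, single (w • x) 1

lemma orbitSum_mem (x : Face W) : orbitSum k x ∈ invariantSubalgebra W k := by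
  intro w
  rw [orbitSum, map_sum]
  simp only [act_single, ← mul_smul]
  exact Equiv.sum_comp (Equiv.mulLeft w) fun u => single (u • x) (1 : k)

lemma orbitSum_smul (w : W) (x : Face W) : orbitSum k (w • x) = orbitSum k x := by
  simp only [orbitSum, ← mul_smul]
  exact Equiv.sum_comp (Equiv.mulRight w) fun u => single (u • x) (1 : k)

lemma card_smul_eq_sum_orbitSum {a : FaceAlgebra W k} (ha : a ∈ invariantSubalgebra W k) :
    (Nat.card W : k) • a = ∑ x, a.coeff x • orbitSum k x := by
  have h : ∑ w : W, act W k w a = (Nat.card W : k) • a := by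
    rw [Finset.sum_congr rfl fun w _ => ha w, Finset.sum_const, Finset.card_univ,
      Nat.card_eq_fintype_card, Nat.cast_smul_eq_nsmul]
  have h2 : ∀ w : W, act W k w a = ∑ x, a.coeff x • single (w • x) 1 := fun w => by
    conv_lhs => rw [eq_sum_single a]
    simp only [map_sum, map_smul, act_single]
  rw [← h, Finset.sum_congr rfl fun w _ => h2 w, Finset.sum_comm]
  simp only [orbitSum, Finset.smul_sum]

open Classical in
lemma coeff_descentElement {G : Type*} [Group G] [Finite G] (S J : Set G) (w : G) :
    (descentElement k S J).coeff w = if w ∈ minimalReps S J then 1 else 0 := by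
  rw [descentElement, coeff_sum, Finsupp.finsetSum_apply]
  simp only [coeff_single, Finsupp.single_apply]
  rw [Finset.sum_ite_eq']
  simp

/-- The orbit sum of a face of `C` is mapped to the basis element of the descent algebra given by
the simple reflections that fix the face, multiplied by the order of a stabilizer. -/
lemma projMap_orbitSum (hW : Subgroup.closure {s | s ∈ W ∧ IsReflection s} = W) (hC : C.IsTop)
    {x : Face W} (hx : x * C = C) : projMap k hC (orbitSum k x) =
      (Nat.card (MulAction.stabilizer W x) : k) •
        descentElement k C.simple (C.fixing x) := by
  classical
  apply coeff_injective
  ext v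
  rw [orbitSum, map_sum, coeff_smul, Finsupp.smul_apply, coeff_descentElement, coeff_sum,
    Finsupp.finsetSum_apply]
  have hiff : ∀ w : W, (w • x) * C = v • C ↔
      w • x = v • x ∧ v ∈ minimalReps C.simple (C.fixing x) := by
    intro w
    rw [Face.mem_minimalReps_iff hW hC hx]
    constructor
    · intro h
      have h1 : (w • x) * (v • C) = v • C := by
        rw [← h, ← mul_assoc, Face.mul_self]
      have h2 : ((v⁻¹ * w) • x) * C = C := by
        rw [← (MulAction.injective v).eq_iff, smul_mul', mul_smul, smul_inv_smul, h1]
      have h3 := Face.smul_eq_of_mul_eq hW hC hx _ h2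
      have h4 : w • x = v • x := by
        rwa [mul_smul, inv_smul_eq_iff] at h3
      exact ⟨h4, h4 ▸ h⟩
    · rintro ⟨h1, h2⟩
      rw [h1, h2]
  simp only [projMap_single, coeff_single, Finsupp.single_apply, Face.IsTop.proj_eq_iff hW hC, hiff]
  by_cases hv : v ∈ minimalReps C.simple (C.fixing x)
  · simp only [hv, and_true, if_true, smul_eq_mul, mul_one, Finset.sum_boole]
    rw [card_filter_smul_eq (g := v) rfl]
  · simp [hv]

theorem isDescentAlgebra_invariantImage
    (hW : Subgroup.closure {s | s ∈ W ∧ IsReflection s} = W) (hC : C.IsTop)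
    (hk : ¬ ringChar k ∣ Nat.card W) :
    IsDescentAlgebra k C.simple (invariantImage k hW hC) := by
  apply le_antisymm
  · rintro _ ⟨a, ha, rfl⟩
    have hcard : (Nat.card W : k) ≠ 0 := natCast_ne_zero_of_dvd hk dvd_rfl
    rw [← inv_smul_smul₀ hcard a, card_smul_eq_sum_orbitSum ha, map_smul, map_sum]
    refine Submodule.smul_mem _ _ (Submodule.sum_mem _ fun x _ => ?_)
    rw [map_smul]
    refine Submodule.smul_mem _ _ ?_
    -- move `x` into the closure of `C`
    have hx : ((hC.proj x)⁻¹ • x) * C = C := by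
      rw [← (MulAction.injective (hC.proj x)).eq_iff, smul_mul', smul_inv_smul,
        Face.IsTop.proj_smul, ← mul_assoc, Face.mul_self]
    rw [← orbitSum_smul (hC.proj x)⁻¹, projMap_orbitSum hW hC hx]
    exact Submodule.smul_mem _ _ (Submodule.subset_span ⟨_, Face.fixing_subset _ _, rfl⟩)
  · rw [Submodule.span_le]
    rintro _ ⟨J, hJ, rfl⟩
    obtain ⟨x, hx, rfl⟩ := Face.exists_fixing_eq hC hJ
    have hcard : (Nat.card (MulAction.stabilizer W x) : k) ≠ 0 :=
      natCast_ne_zero_of_dvd hk (Subgroup.card_subgroup_dvd_card _)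
    rw [← inv_smul_smul₀ hcard (descentElement k _ _), ← projMap_orbitSum hW hC hx]
    exact Submodule.smul_mem _ _ ⟨_, orbitSum_mem x, rfl⟩

end Bidigare

end FaceAlg

end

open FaceAlg
theorem mainTheorem8
    {V : Type*} [AddCommGroup V] [Module ℝ V] [FiniteDimensional ℝ V]
    [TopologicalSpace V] [IsTopologicalAddGroup V] [ContinuousSMul ℝ V] [T2Space V]
    (W : Subgroup (V ≃ₗ[ℝ] V)) [Finite W]
    (hW : Subgroup.closure {s | s ∈ W ∧ IsReflection s} = W)
    {k : Type*} [Field k] (hk : ¬ ringChar k ∣ Nat.card W) :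
    -- the algebra of invariants is split basic, so that it has a quiver
    IsSplitBasic k (invariantSubalgebra W k) ∧
    -- for every family `ℓ` (and there is one) the `ε_𝒪` form a complete system of primitive
    -- orthogonal idempotents, and in the resulting quiver an arrow `𝒪' → 𝒪` forces `𝒪 < 𝒪'`
    (∃ l : Flat W → FaceAlgebra W k, IsInvariantFamily l) ∧
    (∀ l : Flat W → FaceAlgebra W k, IsInvariantFamily l →
      ∃ ε : FlatOrbit W → invariantSubalgebra W k,
        (∀ P, (ε P : FaceAlgebra W k) = orbitIdem l P) ∧
        IsCompleteSystem ε ∧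
        ∀ P' P : FlatOrbit W, Nonempty ((quiverOf k ε).Hom P' P) → P < P') ∧
    -- the quiver, built from any complete system, has no oriented cycles
    (∀ (ι : Type*) [Finite ι] (e : ι → invariantSubalgebra W k), IsCompleteSystem e →
      NoOrientedCycles (quiverOf k e)) ∧
    -- the algebra of invariants is quasi-hereditary
    IsQuasiHereditary (invariantSubalgebra W k) ∧
    -- for every choice of fundamental chamber, so is the descent algebra
    ∀ c : Set V, IsChamber W c →
      ∃ D : Subalgebra k (MonoidAlgebra k W),
        IsDescentAlgebra k (simpleReflections W c) D ∧ IsQuasiHereditary D := by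
  obtain ⟨l, hl⟩ := exists_isInvariantFamily hk
  refine ⟨hl.isTriangular.isSplitBasic hl.orbitIdem_ne_zero, ⟨l, hl⟩, fun l hl => ?_,
    fun ι _ e he => hl.isTriangular.noOrientedCycles hl.orbitIdem_ne_zero he,
    hl.isTriangular.isQuasiHereditary, fun c hc => ?_⟩
  · exact ⟨hl.orbitIdem, fun _ => rfl, hl.isTriangular.isCompleteSystem hl.orbitIdem_ne_zero,
      fun P' P h => hl.isTriangular.lt_of_arrowSpace_ne_bot hl.orbitIdem_ne_zero
        (arrowSpace_ne_bot h)⟩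
  · obtain ⟨C, hC, rfl⟩ := hc.exists_face
    rw [Face.simpleReflections_eq hC]
    exact ⟨invariantImage k hW hC, isDescentAlgebra_invariantImage hW hC hk,
      isQuasiHereditary_invariantImage hW hC hk⟩
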